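/- Let $\mathbb T=\mathbb R/2\pi\mathbb Z$, identified with $[-\pi,\pi)$, and let $\mu$ be normalized Lebesgue measure on $\mathbb T$. Let $X$ be a Banach lattice of measurable functions $\mathbb T\to\mathbb C$, i.e. a Banach space of such functions, each defined and finite at every point, with the following properties: (1) if $f$ is measurable, $g\in X$ and $|f|\le|g|$, then $f\in X$ and $\|f\|_X\le\|g\|_X$; (2) if $f_j\in X$, $\sup_j\|f_j\|_X<\infty$ and $0\le f_j\uparrow f$, then $f\in X$ and $\|f_j\|_X\to\|f\|_X$; (3) for every measurable $E\subset\mathbb T$, $\chi_E\in X$ and $\int_E|f|\,d\mu\le c_E\|f\|_X$ for all $f\in X$. Assume that $X$ is rearrangement-invariant: measurable $f,g$ with $\mu\{|f|\ge y\}=\mu\{|g|\ge y\}$ for all $y$ have the same norm in $X$ (with the norm being $\infty$ outside $X$). For $n\in\mathbb N=\{1,2,\dots\}$ let $G_nf=\sum_{k=1}^{m_n}f(x_{k,n})\varphi_{k,n}$, where $\varphi_{k,n}\in X$ and the nodes satisfy $\gamma/n\le x_{k+1,n}-x_{k,n}\le\gamma'/n$ for $k=1,\dots,m_n$, with $x_{m_n+1,n}=2\pi+x_{1,n}$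 and constants $\gamma,\gamma'>0$ independent of $n$ and $k$. Put $\|f\|_{X_n}=\big\|\sum_{k=1}^{m_n}|f(x_{k,n})|\chi_{[x_{k,n},x_{k+1,n})}\big\|_X$, and let $\mathcal T_n$ be the space of complex trigonometric polynomials of degree at most $n$. Let $s\in\mathbb N$ and assume that there are constants $K_1,K_3$ such that, for all $n\in\mathbb N$, $$(A_1)\quad \|G_nf\|_X\le K_1\|f\|_{X_n}\ \ (f\in X),\qquad (A_3)\quad \|T-G_nT\|_X\le K_3n^{-s}\|T^{(s)}\|_X\ \ (T\in\mathcal T_n).$$ Let $E_n(f)_X=\inf_{T\in\mathcal T_n}\|f-T\|_X$ and $\omega_s(f,\delta)_X=\sup_{0<h\le\delta}\|\Delta_h^sf\|_X$, where $\Delta_h^sf(x)=\sum_{\nu=0}^s(-1)^\nu\binom s\nu f(x+(s-\nu)h)$; for $0<r<1$ let $\delta_rf(x)=f(rx)$, $x\in[-\pi,\pi)$, and let $\|\delta_r\|_{X\to X}=\sup_{\|f\|_X\le1}\|\delta_rf\|_X$. Then there is a constant $C$ such that for all $n\in\mathbb N$ and all $f\in X$ with the property that $f$ equals $g$ at every point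 whenever $g$ is continuous on $\mathbb T$ and $f=g$ almost everywhere (in particular, for every continuous $f$), $$\|f-G_nf\|_X\le C\Big(\omega_s(f,1/n)_X+\sum_{\nu=1}^\infty\|\delta_{2^{-\nu}}\|_{X\to X}\,E_{2^{\nu-1}n}(f)_X\Big),$$ where the right-hand side may be $+\infty$. If, in addition, $G_nT=T$ for all $T\in\mathcal T_n$ and all $n\in\mathbb N$, then there is a constant $C$ such that, for the same $f$ and $n$, the estimate holds without the term $\omega_s(f,1/n)_X$. -/

import Mathlib

open Set Filter Topology MeasureTheory
open scoped ENNReal NNReal Real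

instance factTwoPiPos : Fact (0 < 2 * π) := ⟨Real.two_pi_pos⟩

/-- The circle `ℝ / 2πℤ`. -/
abbrev Torus : Type := AddCircle (2 * π)

/-- Normalized Lebesgue measure on the circle (total mass one). -/
noncomputable abbrev torusMeasure : Measure Torus := AddCircle.haarAddCircle

/-- A Banach function lattice `X` on the circle. Its elements are functions defined at every point
(not equivalence classes). It is encoded by its extended norm: `eNorm f` is `‖f‖_X` if `f ∈ X`,
and `∞` if `f ∉ X`. "Measurable" means Lebesgue measurable, i.e. a.e. equal to a Borel function. -/
structure BanachFunctionLattice where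
  eNorm : (Torus → ℂ) → ℝ≥0∞
  aemeasurable_of_mem : ∀ f, eNorm f < ∞ → AEMeasurable f torusMeasure
  eNorm_add_le : ∀ f g, eNorm (f + g) ≤ eNorm f + eNorm g
  eNorm_smul : ∀ (c : ℂ) (f), eNorm (c • f) = ‖c‖ₑ * eNorm f
  /-- completeness -/
  complete : ∀ u : ℕ → Torus → ℂ, (∀ n, eNorm (u n) < ∞) →
    (∀ ε : ℝ≥0∞, 0 < ε → ∃ N, ∀ m ≥ N, ∀ n ≥ N, eNorm (u m - u n) < ε) →
    ∃ f, eNorm f < ∞ ∧ Tendsto (fun n => eNorm (u n - f)) atTop (𝓝 0)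
  /-- lattice property -/
  eNorm_mono : ∀ f g, AEMeasurable f torusMeasure → eNorm g < ∞ → (∀ x, ‖f x‖ ≤ ‖g x‖) →
    eNorm f ≤ eNorm g
  /-- Fatou property (the limit relation and the bound also give `f ∈ X`) -/
  fatou : ∀ (u : ℕ → Torus → ℝ) (f : Torus → ℝ),
    (∀ n x, 0 ≤ u n x) → (∀ x, Monotone fun n => u n x) →
    (∀ x, Tendsto (fun n => u n x) atTop (𝓝 (f x))) →
    (⨆ n, eNorm fun x => (u n x : ℂ)) < ∞ →
    Tendsto (fun n => eNorm fun x => (u n x : ℂ)) atTop (𝓝 (eNorm fun x => (f x : ℂ)))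
  /-- characteristic functions of measurable sets belong to `X` -/
  indicator_mem : ∀ E : Set Torus, NullMeasurableSet E torusMeasure →
    eNorm (E.indicator fun _ => 1) < ∞
  /-- `∫_E |f| dμ ≤ c_E ‖f‖_X` -/
  lintegral_le : ∀ E : Set Torus, NullMeasurableSet E torusMeasure →
    ∃ c : ℝ≥0, ∀ f, eNorm f < ∞ → ∫⁻ x in E, ‖f x‖ₑ ∂torusMeasure ≤ c * eNorm f

namespace BanachFunctionLattice

/-- Membership `f ∈ X`. -/
def Mem (X : BanachFunctionLattice) (f : Torus → ℂ) : Prop := X.eNorm f < ∞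

/-- `X` is rearrangement-invariant: measurable functions with the same distribution function
`y ↦ μ {x : |f x| ≥ y}` have the same norm. -/
def RearrangementInvariant (X : BanachFunctionLattice) : Prop :=
  ∀ f g : Torus → ℂ, AEMeasurable f torusMeasure → AEMeasurable g torusMeasure →
    (∀ y : ℝ, torusMeasure {x | y ≤ ‖f x‖} = torusMeasure {x | y ≤ ‖g x‖}) →
    X.eNorm f = X.eNorm g

end BanachFunctionLattice

/-- Trigonometric polynomials of degree at most `n`: the span of `e^{ikx}`, `|k| ≤ n`. -/
def trigPoly (n : ℕ) : Submodule ℂ (Torus → ℂ) :=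
  Submodule.span ℂ {e | ∃ k : ℤ, |k| ≤ (n : ℤ) ∧ e = fun x => fourier k x}

/-- The `s`-th derivative of a function on the circle with respect to the real variable. -/
noncomputable def torusDeriv (s : ℕ) (f : Torus → ℂ) : Torus → ℂ :=
  AddCircle.liftIco (2 * π) (-π) (iteratedDeriv s fun t : ℝ => f (t : Torus))

/-- The dilation `δ_r f (x) = f (r x)`, `x ∈ [-π, π)`, where the circle is identified
with `[-π, π)`. -/
noncomputable def dilation (r : ℝ) (f : Torus → ℂ) : Torus → ℂ :=
  AddCircle.liftIco (2 * π) (-π) fun t : ℝ => f ((r * t : ℝ) : Torus)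

/-- The difference `Δ_h^s f (x) = ∑_{ν=0}^{s} (-1)^ν (s choose ν) f (x + (s - ν) h)`. -/
noncomputable def difference (s : ℕ) (h : ℝ) (f : Torus → ℂ) : Torus → ℂ := fun x =>
  ∑ ν ∈ Finset.range (s + 1),
    (-1 : ℂ) ^ ν * (s.choose ν : ℂ) * f (x + ((((s : ℝ) - ν) * h : ℝ) : Torus))

namespace BanachFunctionLattice

/-- The error of best approximation `E_n(f)_X`. -/
noncomputable def bestApprox (X : BanachFunctionLattice) (n : ℕ) (f : Torus → ℂ) : ℝ≥0∞ :=
  ⨅ T ∈ trigPoly n, X.eNorm (f - T)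

/-- The modulus of smoothness `ω_s(f, δ)_X`. -/
noncomputable def modulus (X : BanachFunctionLattice) (s : ℕ) (f : Torus → ℂ) (δ : ℝ) : ℝ≥0∞ :=
  ⨆ h ∈ Ioc (0 : ℝ) δ, X.eNorm (difference s h f)

/-- The operator norm `‖δ_r‖_{X → X}`. -/
noncomputable def dilationNorm (X : BanachFunctionLattice) (r : ℝ) : ℝ≥0∞ :=
  ⨆ (f : Torus → ℂ) (_ : X.eNorm f ≤ 1), X.eNorm (dilation r f)

end BanachFunctionLattice

/-- The data of a sequence of sampling operators in `X`. For `n ≥ 1` the nodes are the (distinct)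
points of the circle represented by `node n 0 < ⋯ < node n (m n - 1)`, and `node n (m n)` is the
first node shifted by a full period (so `m n ≥ 1`). -/
structure SamplingFamily (X : BanachFunctionLattice) where
  m : ℕ → ℕ
  node : ℕ → ℕ → ℝ
  φ : ℕ → ℕ → Torus → ℂ
  γ : ℝ
  γ' : ℝ
  γ_pos : 0 < γ
  γ'_pos : 0 < γ'
  φ_mem : ∀ n, 1 ≤ n → ∀ k < m n, X.Mem (φ n k)
  node_period : ∀ n, 1 ≤ n → node n (m n) = 2 * π + node n 0
  gap_lower : ∀ n, 1 ≤ n → ∀ k < m n, γ / n ≤ node n (k + 1) - node n k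
  gap_upper : ∀ n, 1 ≤ n → ∀ k < m n, node n (k + 1) - node n k ≤ γ' / n

namespace SamplingFamily

variable {X : BanachFunctionLattice}

/-- The sampling operator `G_n f = ∑_k f(x_{k,n}) φ_{k,n}`. -/
noncomputable def op (G : SamplingFamily X) (n : ℕ) (f : Torus → ℂ) : Torus → ℂ := fun x =>
  ∑ k ∈ Finset.range (G.m n), f (G.node n k : Torus) * G.φ n k x

/-- The arc `[x_k, x_{k+1})` of the circle. -/
noncomputable def arc (G : SamplingFamily X) (n k : ℕ) : Set Torus :=
  (fun t : ℝ => (t : Torus)) '' Ico (G.node n k) (G.node n (k + 1))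

/-- The step function `∑_k |f(x_k)| χ_{[x_k, x_{k+1})}`. -/
noncomputable def step (G : SamplingFamily X) (n : ℕ) (f : Torus → ℂ) : Torus → ℂ := fun y =>
  ∑ k ∈ Finset.range (G.m n),
    (G.arc n k).indicator (fun _ => ((‖f (G.node n k : Torus)‖ : ℝ) : ℂ)) y

/-- The semi-norm `‖f‖_{X_n}`. -/
noncomputable def discreteNorm (G : SamplingFamily X) (n : ℕ) (f : Torus → ℂ) : ℝ≥0∞ :=
  X.eNorm (G.step n f)

/-- `‖G_n f‖_X ≤ K₁ ‖f‖_{X_n}` for all `f ∈ X` and `n ≥ 1`. -/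
def Stable (G : SamplingFamily X) : Prop :=
  ∃ K₁ : ℝ≥0, ∀ n, 1 ≤ n → ∀ f, X.Mem f → X.eNorm (G.op n f) ≤ K₁ * G.discreteNorm n f

/-- `‖T - G_n T‖_X ≤ K₃ n^{-s} ‖T^{(s)}‖_X` for all `T ∈ 𝒯_n` and `n ≥ 1`. -/
def ApproximatesOfOrder (G : SamplingFamily X) (s : ℕ) : Prop :=
  ∃ K₃ : ℝ≥0, ∀ n : ℕ, 1 ≤ n → ∀ T ∈ trigPoly n,
    X.eNorm (T - G.op n T) ≤ K₃ * ((n : ℝ≥0∞) ^ s)⁻¹ * X.eNorm (torusDeriv s T)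

/-- `G_n T = T` for all `T ∈ 𝒯_n` and `n ≥ 1`. -/
def Reproduces (G : SamplingFamily X) : Prop :=
  ∀ n : ℕ, 1 ≤ n → ∀ T ∈ trigPoly n, G.op n T = T

end SamplingFamily

/-- If the everywhere defined function `f` agrees almost everywhere with a continuous function,
then it is that continuous function. (Every continuous `f` satisfies this, and so does every `f`
that is not almost everywhere equal to a continuous function.) -/
def IsContinuousRepresentative (f : Torus → ℂ) : Prop :=
  ∀ g : C(Torus, ℂ), f =ᵐ[torusMeasure] g → ∀ x, f x = g x

/-! ### Elementary properties of the norm; translations, differences and dilations -/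

namespace BanachFunctionLattice

variable (X : BanachFunctionLattice)

/-! Choose nearly best approximants `T ν` of degree `2 ^ ν * n` and write `f - G f = (f - T 0) + (T
0 - G (T 0)) - G (f - T 0)`. The first term is controlled by the best approximation of degree `n`.
The second vanishes if `G` reproduces polynomials; otherwise the approximation assumption bounds it
by `n⁻ˢ` times the norm of the `s`-th derivative of `T 0`, which the Nikolskii–Stechkin inequality
(`eNorm_torusDeriv_le`) turns into an `s`-th difference of `T 0`, hence into the modulus of `f` plus
the norm of `f - T 0`.

By stability the third term reduces to the discrete norm of `f - T 0`. This function is the sum of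
the blocks `T (ν + 1) - T ν`, so it suffices to bound the discrete norm of a polynomial of degree `2
^ ν * n` sampled at nodes of density only `n` (`discreteNorm_trigPoly_le`). On arcs of length `r * γ
/ n`, `r = 2 ^ (-ν)`, matched to the degree, a Taylor expansion and Bernstein's inequality bound the
step function of the samples by a constant times the norm of the polynomial
(`eNorm_stepFn_samples_le`). Rearrangement invariance allows these short arcs to be placed side by
side around the origin, where `δ_r` stretches them to length `γ / n`; this is the source of the
dilation norm. Finitely many shifts then fill the arcs between the nodes.

Samples are point values, so the telescoping series must converge to `f` at the nodes and not only
in `X`. The same sampling bound gives a sup-norm estimate (`enorm_trigPoly_mul_le`), so the series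
converges uniformly to a continuous function; that function equals `f` almost everywhere, hence
everywhere by the assumption on `f` (`hasSum_of_tendsto`).

Bernstein's inequality comes from expanding the symbol `i k`, `|k| ≤ N`, in an absolutely convergent
series of exponentials: differentiation becomes a summable combination of translations, which are
isometries of `X`. -/

theorem eNorm_zero : X.eNorm 0 = 0 := by
  have h := X.eNorm_smul 0 0
  simpa using h

theorem eNorm_sub_le (f g : Torus → ℂ) : X.eNorm (f - g) ≤ X.eNorm f + X.eNorm g := by
  have h := X.eNorm_smul (-1) g
  have h2 := X.eNorm_add_le f ((-1 : ℂ) • g)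
  rw [h] at h2
  simpa [sub_eq_add_neg] using h2

theorem eNorm_sum_le {ι : Type*} (s : Finset ι) (u : ι → Torus → ℂ) :
    X.eNorm (∑ i ∈ s, u i) ≤ ∑ i ∈ s, X.eNorm (u i) := by
  classical
  induction s using Finset.induction_on with
  | empty => simp [X.eNorm_zero]
  | insert a s ha ih =>
    rw [Finset.sum_insert ha, Finset.sum_insert ha]
    exact (X.eNorm_add_le _ _).trans (by gcongr)

theorem eNorm_norm_le (f : Torus → ℂ) : X.eNorm (fun x => ((‖f x‖ : ℝ) : ℂ)) ≤ X.eNorm f := by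
  rcases eq_or_ne (X.eNorm f) ∞ with h | h
  · simp [h]
  · have hf := X.aemeasurable_of_mem f h.lt_top
    refine X.eNorm_mono _ _ ?_ h.lt_top fun x => by simp
    exact Complex.measurable_ofReal.comp_aemeasurable hf.norm

/-- The countable triangle inequality, a consequence of the Fatou property. -/
theorem eNorm_le_tsum (f : Torus → ℂ) (u : ℕ → Torus → ℂ) (hf : AEMeasurable f torusMeasure)
    (hsum : ∀ x, Summable fun m => ‖u m x‖) (hle : ∀ x, ‖f x‖ ≤ ∑' m, ‖u m x‖) :
    X.eNorm f ≤ ∑' m, X.eNorm (u m) := by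
  rcases eq_or_ne (∑' m, X.eNorm (u m)) ∞ with h | h
  · simp [h]
  have hbound : ∀ n, X.eNorm (fun x => ((∑ m ∈ Finset.range n, ‖u m x‖ : ℝ) : ℂ))
      ≤ ∑' m, X.eNorm (u m) := by
    intro n
    have : (fun x => ((∑ m ∈ Finset.range n, ‖u m x‖ : ℝ) : ℂ))
        = ∑ m ∈ Finset.range n, fun x => ((‖u m x‖ : ℝ) : ℂ) := by
      ext x; simp
    rw [this]
    refine (X.eNorm_sum_le _ _).trans ?_
    exact (Finset.sum_le_sum fun m _ => X.eNorm_norm_le (u m)).trans (ENNReal.sum_le_tsum _)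
  have hF := X.fatou (fun n x => ∑ m ∈ Finset.range n, ‖u m x‖) (fun x => ∑' m, ‖u m x‖)
    (fun n x => Finset.sum_nonneg fun _ _ => norm_nonneg _)
    (fun x => monotone_nat_of_le_succ fun n => by
      rw [Finset.sum_range_succ]; exact le_add_of_nonneg_right (norm_nonneg _))
    (fun x => (hsum x).hasSum.tendsto_sum_nat)
    ((iSup_le hbound).trans_lt h.lt_top)
  have hle' := le_of_tendsto' hF hbound
  refine (X.eNorm_mono f _ hf (hle'.trans_lt h.lt_top) fun x => ?_).trans hle'
  rw [Complex.norm_real, Real.norm_of_nonneg (tsum_nonneg fun _ => norm_nonneg _)]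
  exact hle x

theorem eNorm_const_lt_top (c : ℂ) : X.eNorm (fun _ => c) < ∞ := by
  have h := X.indicator_mem univ nullMeasurableSet_univ
  have h2 := X.eNorm_smul c (univ.indicator fun _ => 1)
  have h3 : (c • (univ.indicator fun _ => 1) : Torus → ℂ) = fun _ => c := by ext x; simp
  rw [h3] at h2
  rw [h2]
  exact ENNReal.mul_lt_top (by simp) h

theorem eNorm_lt_top_of_bounded {f : Torus → ℂ} (hf : AEMeasurable f torusMeasure) {M : ℝ}
    (hM : ∀ x, ‖f x‖ ≤ M) : X.eNorm f < ∞ := by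
  have hM0 : 0 ≤ M := (norm_nonneg _).trans (hM 0)
  refine (X.eNorm_mono f (fun _ => (M : ℂ)) hf (X.eNorm_const_lt_top _) fun x => ?_).trans_lt
    (X.eNorm_const_lt_top _)
  rw [Complex.norm_real, Real.norm_of_nonneg hM0]; exact hM x

theorem eNorm_pos {f : Torus → ℂ} (hf : X.eNorm f < ∞)
    (h : ∫⁻ x, ‖f x‖ₑ ∂torusMeasure ≠ 0) : X.eNorm f ≠ 0 := by
  obtain ⟨c, hc⟩ := X.lintegral_le univ nullMeasurableSet_univ
  intro h0
  have := hc f hf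
  rw [h0, mul_zero, Measure.restrict_univ] at this
  exact h (le_antisymm this zero_le)

variable {X}

/-- Rearrangement-invariant norms are translation-invariant. -/
theorem RearrangementInvariant.eNorm_translate_le (hX : X.RearrangementInvariant) (f : Torus → ℂ)
    (a : Torus) : X.eNorm (fun x => f (x + a)) ≤ X.eNorm f := by
  rcases eq_or_ne (X.eNorm f) ∞ with h | h
  · simp [h]
  have hf := X.aemeasurable_of_mem f h.lt_top
  have hmp := measurePreserving_add_right torusMeasure a
  refine (hX _ _ (hf.comp_quasiMeasurePreserving hmp.quasiMeasurePreserving) hf fun y => ?_).le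
  exact measure_preimage_add_right torusMeasure a {x | y ≤ ‖f x‖}

theorem RearrangementInvariant.eNorm_translate (hX : X.RearrangementInvariant) (f : Torus → ℂ)
    (a : Torus) : X.eNorm (fun x => f (x + a)) = X.eNorm f := by
  refine le_antisymm (hX.eNorm_translate_le f a) ?_
  have h := hX.eNorm_translate_le (fun x => f (x + a)) (-a)
  simpa using h

theorem RearrangementInvariant.eNorm_difference_le (hX : X.RearrangementInvariant) (s : ℕ) (h : ℝ)
    (f : Torus → ℂ) : X.eNorm (difference s h f) ≤ 2 ^ s * X.eNorm f := by
  have hd : difference s h f = ∑ ν ∈ Finset.range (s + 1), ((-1 : ℂ) ^ ν * (s.choose ν : ℂ)) •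
      fun x => f (x + ((((s : ℝ) - ν) * h : ℝ) : Torus)) := by
    ext x; simp [difference]
  rw [hd]
  refine (X.eNorm_sum_le _ _).trans ?_
  have : ∀ ν ∈ Finset.range (s + 1), X.eNorm (((-1 : ℂ) ^ ν * (s.choose ν : ℂ)) •
      fun x => f (x + ((((s : ℝ) - ν) * h : ℝ) : Torus))) = (s.choose ν : ℝ≥0∞) * X.eNorm f := by
    intro ν _
    rw [X.eNorm_smul, hX.eNorm_translate]
    congr 1
    rw [enorm_mul, enorm_pow]
    simp [← ofReal_norm]
  rw [Finset.sum_congr rfl this, ← Finset.sum_mul]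
  gcongr
  have := Nat.sum_range_choose s
  exact_mod_cast this.le

theorem difference_sub (s : ℕ) (h : ℝ) (f g : Torus → ℂ) :
    difference s h (f - g) = difference s h f - difference s h g := by
  ext x
  simp [difference, mul_sub]

/-- Homogeneity extends the bound from the unit ball. Finiteness of the dilation norm matters when
`g` has norm zero: the product `∞ * 0` would be `0`. -/
theorem eNorm_dilation_le {r : ℝ} (hD : X.dilationNorm r ≠ ∞) {g : Torus → ℂ}
    (hg : X.eNorm g ≠ ∞) : X.eNorm (dilation r g) ≤ X.dilationNorm r * X.eNorm g := by
  have hsmul : ∀ c : ℂ, dilation r (c • g) = c • dilation r g := by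
    intro c; ext x
    obtain ⟨t, ht, rfl⟩ := AddCircle.coe_image_Ico_eq (2 * π) (-π) ▸ mem_univ x
    simp only [dilation, Pi.smul_apply]
    rw [AddCircle.liftIco_coe_apply ht, AddCircle.liftIco_coe_apply ht]
  have key : ∀ c : ℝ≥0, c * X.eNorm g ≤ 1 → c * X.eNorm (dilation r g) ≤ X.dilationNorm r := by
    intro c hc
    have hn : ‖((c : ℝ) : ℂ)‖ₑ = c := by
      rw [← ofReal_norm, Complex.norm_real]; simp
    have h1 : X.eNorm (((c : ℝ) : ℂ) • g) ≤ 1 := by rw [X.eNorm_smul, hn]; exact hc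
    have h2 := le_iSup₂ (f := fun (f : Torus → ℂ) (_ : X.eNorm f ≤ 1) => X.eNorm (dilation r f))
      _ h1
    rw [hsmul, X.eNorm_smul, hn] at h2
    exact h2
  rcases eq_or_ne (X.eNorm g) 0 with h0 | h0
  -- Here `key` applies to every multiple of `g`, so a nonzero norm of `dilation r g` would exceed
  -- the finite dilation norm.
  · rw [h0, mul_zero, nonpos_iff_eq_zero]
    by_contra hne
    obtain ⟨n, hn⟩ := ENNReal.exists_nat_mul_gt hne hD
    have := key n (by simp [h0])
    exact absurd this (not_le.2 (by simpa using hn))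
  · have hi : (X.eNorm g)⁻¹ ≠ ∞ := ENNReal.inv_ne_top.2 h0
    have := key (X.eNorm g)⁻¹.toNNReal (by
      rw [ENNReal.coe_toNNReal hi, ENNReal.inv_mul_cancel h0 hg])
    rw [ENNReal.coe_toNNReal hi, mul_comm, ← div_eq_mul_inv] at this
    rwa [ENNReal.div_le_iff h0 hg] at this

/-- Constants are fixed by dilation, and the constant `1` has positive finite norm. This allows an
error of best approximation to be absorbed into its weighted version. -/
theorem one_le_dilationNorm (r : ℝ) : 1 ≤ X.dilationNorm r := by
  set e := X.eNorm (fun _ => 1) with he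
  have hfin : e ≠ ∞ := (X.eNorm_const_lt_top 1).ne
  have h0 : e ≠ 0 := X.eNorm_pos hfin.lt_top (by simp)
  by_cases hD : X.dilationNorm r = ∞
  · simp [hD]
  have h := eNorm_dilation_le hD (g := fun _ => (1 : ℂ)) hfin
  have hd : dilation r (fun _ => (1 : ℂ)) = fun _ => 1 := by
    ext x
    obtain ⟨t, ht, rfl⟩ := AddCircle.coe_image_Ico_eq (2 * π) (-π) ▸ mem_univ x
    rw [dilation, AddCircle.liftIco_coe_apply ht]
  rw [hd, ← he] at h
  by_contra hlt
  have := ENNReal.mul_lt_mul_left h0 hfin (not_le.1 hlt)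
  rw [one_mul] at this
  exact absurd h (not_le.2 (by simpa [mul_comm] using this))

end BanachFunctionLattice

/-! ### Trigonometric polynomials; derivatives and differences as Fourier multipliers -/

/-- The trigonometric polynomial `∑_{|k| ≤ N} c_k e^{ikx}`. -/
noncomputable def trigSum (N : ℕ) (c : ℤ → ℂ) : Torus → ℂ := fun x =>
  ∑ k ∈ Finset.Icc (-(N : ℤ)) N, c k * fourier k x

theorem HasSum.of_eq {E : Type*} [AddCommMonoid E] [TopologicalSpace E] {f g : ℕ → E} {a b : E}
    (h : HasSum f a) (hfg : ∀ j, g j = f j) (hab : b = a) : HasSum g b := by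
  rw [funext hfg, hab]; exact h

theorem fourier_torus_coe (k : ℤ) (t : ℝ) :
    fourier k (t : Torus) = Complex.exp (Complex.I * k * t) := by
  rw [fourier_coe_apply]
  congr 1
  have : (π : ℂ) ≠ 0 := by exact_mod_cast Real.pi_ne_zero
  push_cast
  field_simp

theorem fourier_torus_add (k : ℤ) (x : Torus) (t : ℝ) :
    fourier k (x + (t : Torus)) = Complex.exp (Complex.I * k * t) * fourier k x := by
  rw [← fourier_torus_coe, fourier_apply, fourier_apply, fourier_apply, smul_add,
    AddCircle.toCircle_add, Circle.coe_mul, mul_comm]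

theorem mem_trigPoly_iff {N : ℕ} {T : Torus → ℂ} : T ∈ trigPoly N ↔ ∃ c, T = trigSum N c := by
  constructor
  · intro hT
    induction hT using Submodule.span_induction with
    | mem x hx =>
      obtain ⟨k, hk, rfl⟩ := hx
      refine ⟨Pi.single k 1, ?_⟩
      ext x
      rw [trigSum, Finset.sum_eq_single k]
      · simp
      · intro j _ hj; simp [hj]
      · intro h; exact absurd (Finset.mem_Icc.2 (abs_le.1 hk)) h
    | zero => exact ⟨0, by ext x; simp [trigSum]⟩
    | add x y _ _ hx hy =>
      obtain ⟨c, rfl⟩ := hx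
      obtain ⟨d, rfl⟩ := hy
      exact ⟨c + d, by ext x; simp [trigSum, add_mul, Finset.sum_add_distrib]⟩
    | smul a x _ hx =>
      obtain ⟨c, rfl⟩ := hx
      exact ⟨a • c, by ext x; simp [trigSum, Finset.mul_sum, mul_assoc]⟩
  · rintro ⟨c, rfl⟩
    have : trigSum N c = ∑ k ∈ Finset.Icc (-(N : ℤ)) N, c k • fun x => fourier k x := by
      ext x; simp [trigSum]
    rw [this]
    refine Submodule.sum_mem _ fun k hk => Submodule.smul_mem _ _ (Submodule.subset_span ?_)
    exact ⟨k, abs_le.2 (Finset.mem_Icc.1 hk), rfl⟩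

theorem trigPoly_mono {M N : ℕ} (h : M ≤ N) : trigPoly M ≤ trigPoly N := by
  refine Submodule.span_mono ?_
  rintro _ ⟨k, hk, rfl⟩
  exact ⟨k, hk.trans (by exact_mod_cast h), rfl⟩

theorem trigSum_translate (N : ℕ) (c : ℤ → ℂ) (t : ℝ) :
    (fun x : Torus => trigSum N c (x + (t : Torus)))
      = trigSum N fun k => Complex.exp (Complex.I * k * t) * c k := by
  ext x
  simp only [trigSum, fourier_torus_add]
  exact Finset.sum_congr rfl fun k _ => by ring

theorem continuous_trigSum (N : ℕ) (c : ℤ → ℂ) : Continuous (trigSum N c) := by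
  unfold trigSum; fun_prop

theorem norm_trigSum_le (N : ℕ) (c : ℤ → ℂ) (x : Torus) :
    ‖trigSum N c x‖ ≤ ∑ k ∈ Finset.Icc (-(N : ℤ)) N, ‖c k‖ := by
  refine (norm_sum_le _ _).trans (Finset.sum_le_sum fun k _ => ?_)
  rw [norm_mul, fourier_apply, Circle.norm_coe, mul_one]

theorem eNorm_trigSum_lt_top (X : BanachFunctionLattice) (N : ℕ) (c : ℤ → ℂ) :
    X.eNorm (trigSum N c) < ∞ :=
  X.eNorm_lt_top_of_bounded (continuous_trigSum N c).measurable.aemeasurable (norm_trigSum_le N c)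

theorem torusDeriv_trigSum (s N : ℕ) (c : ℤ → ℂ) :
    torusDeriv s (trigSum N c) = trigSum N fun k => (Complex.I * k) ^ s * c k := by
  have hd : iteratedDeriv s (fun t : ℝ => trigSum N c (t : Torus))
      = fun t : ℝ => trigSum N (fun k => (Complex.I * k) ^ s * c k) (t : Torus) := by
    induction s generalizing c with
    | zero => simp
    | succ s ih =>
      rw [iteratedDeriv_succ', show deriv (fun t : ℝ => trigSum N c (t : Torus))
        = fun t : ℝ => trigSum N (fun k => (Complex.I * k) * c k) (t : Torus) from ?_, ih]
      · ext t; congr 2; ext k; ring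
      · ext t
        simp only [trigSum, fourier_torus_coe]
        refine HasDerivAt.deriv (HasDerivAt.fun_sum fun k _ => ?_)
        have h1 : HasDerivAt (fun t : ℝ => Complex.I * k * (t : ℂ)) (Complex.I * k * 1) t :=
          (Complex.ofRealCLM.hasDerivAt (x := t)).const_mul _
        exact (h1.cexp.const_mul (c k)).congr_deriv (by ring)
  rw [torusDeriv, hd]
  refine AddCircle.Ico_ext (p := 2 * π) (-π) fun t ht => ?_
  rw [AddCircle.liftIco_coe_apply ht]

/-- Taylor expansion of a trigonometric polynomial. -/
theorem hasSum_trigSum_taylor (N : ℕ) (c : ℤ → ℂ) (x : Torus) (t : ℝ) :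
    HasSum (fun m : ℕ => (t : ℂ) ^ m / m.factorial *
      trigSum N (fun k => (Complex.I * k) ^ m * c k) x) (trigSum N c (x + (t : Torus))) := by
  rw [congrFun (trigSum_translate N c t) x]
  simp only [trigSum, Finset.mul_sum]
  refine hasSum_sum fun k _ => ?_
  have h := NormedSpace.expSeries_div_hasSum_exp (Complex.I * k * t)
  rw [← Complex.exp_eq_exp_ℂ] at h
  refine (h.mul_right (c k * fourier k x)).of_eq (fun m => ?_) ?_
  · ring
  · ring

theorem difference_trigSum (s N : ℕ) (h : ℝ) (c : ℤ → ℂ) :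
    difference s h (trigSum N c)
      = trigSum N fun k => (Complex.exp (Complex.I * k * h) - 1) ^ s * c k := by
  ext x
  have hpow : ∀ k : ℤ, (Complex.exp (Complex.I * k * h) - 1) ^ s
      = ∑ ν ∈ Finset.range (s + 1), (-1 : ℂ) ^ ν * (s.choose ν : ℂ) *
          Complex.exp (Complex.I * k * (((s : ℝ) - ν) * h : ℝ)) := by
    intro k
    rw [sub_eq_neg_add, add_pow]
    refine Finset.sum_congr rfl fun ν hν => ?_
    have hν' : ν ≤ s := Nat.lt_succ_iff.1 (Finset.mem_range.1 hν)
    rw [← Complex.exp_nat_mul, Nat.cast_sub hν']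
    push_cast
    rw [show ((s : ℂ) - ν) * (Complex.I * k * h) = Complex.I * k * ((s - ν) * h) by ring]
    ring
  simp only [difference, trigSum, fourier_torus_add, hpow, Finset.mul_sum, Finset.sum_mul]
  rw [Finset.sum_comm]
  exact Finset.sum_congr rfl fun k _ => Finset.sum_congr rfl fun ν _ => by ring

/-! ### Bernstein and Nikolskii–Stechkin inequalities -/

namespace BanachFunctionLattice

variable {X : BanachFunctionLattice}

/-- Fourier multipliers that are absolutely convergent combinations of translations. -/
theorem RearrangementInvariant.eNorm_multiplier_le (hX : X.RearrangementInvariant) (N : ℕ)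
    (c ψ : ℤ → ℂ) (α β : ℕ → ℂ) (b τ : ℕ → ℝ) (hα : ∀ j, ‖α j‖ ≤ b j) (hβ : ∀ j, ‖β j‖ ≤ b j)
    (hb : Summable b)
    (hψ : ∀ k : ℤ, k ∈ Finset.Icc (-(N : ℤ)) N → HasSum (fun j =>
      α j * Complex.exp (Complex.I * k * τ j) + β j * Complex.exp (Complex.I * k * (-τ j : ℝ)))
      (ψ k)) :
    X.eNorm (trigSum N fun k => ψ k * c k)
      ≤ ENNReal.ofReal (2 * ∑' j, b j) * X.eNorm (trigSum N c) := by
  have hb0 : ∀ j, 0 ≤ b j := fun j => (norm_nonneg _).trans (hα j)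
  set T := trigSum N c with hT
  set M := ∑ k ∈ Finset.Icc (-(N : ℤ)) N, ‖c k‖ with hM
  set w : ℕ → Torus → ℂ := fun j =>
    (α j • fun x => T (x + (τ j : Torus))) + (β j • fun x => T (x + ((-τ j : ℝ) : Torus))) with hw
  have hsum : ∀ x, HasSum (fun j => w j x) (trigSum N (fun k => ψ k * c k) x) := by
    intro x
    have : ∀ j, w j x = ∑ k ∈ Finset.Icc (-(N : ℤ)) N, (α j * Complex.exp (Complex.I * k * τ j) +
        β j * Complex.exp (Complex.I * k * (-τ j : ℝ))) * (c k * fourier k x) := by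
      intro j
      simp only [hw, Pi.add_apply, Pi.smul_apply, smul_eq_mul, hT, trigSum, fourier_torus_add,
        Finset.mul_sum]
      rw [← Finset.sum_add_distrib]
      exact Finset.sum_congr rfl fun k _ => by ring
    simp only [this, trigSum, mul_assoc]
    refine hasSum_sum fun k hk => ?_
    have := (hψ k hk).mul_right (c k * fourier k x)
    simpa only [mul_assoc] using this
  have hbd : ∀ x j, ‖w j x‖ ≤ b j * (2 * M) := by
    intro x j
    calc ‖w j x‖ ≤ ‖α j‖ * ‖T (x + (τ j : Torus))‖ + ‖β j‖ * ‖T (x + ((-τ j : ℝ) : Torus))‖ := by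
          simpa only [hw, Pi.add_apply, Pi.smul_apply, smul_eq_mul, norm_mul] using
            norm_add_le (α j * T (x + (τ j : Torus))) (β j * T (x + ((-τ j : ℝ) : Torus)))
      _ ≤ b j * M + b j * M := by
          gcongr
          · exact hb0 j
          · exact hα j
          · exact norm_trigSum_le N c _
          · exact hb0 j
          · exact hβ j
          · exact norm_trigSum_le N c _
      _ = _ := by ring
  have hsn : ∀ x, Summable fun j => ‖w j x‖ := fun x =>
    Summable.of_nonneg_of_le (fun _ => norm_nonneg _) (hbd x) (hb.mul_right _)
  have henorm : ∀ (z : ℂ) (j), ‖z‖ ≤ b j → ‖z‖ₑ ≤ ENNReal.ofReal (b j) := fun z j h => by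
    rw [← ofReal_norm]; exact ENNReal.ofReal_le_ofReal h
  refine (X.eNorm_le_tsum _ w (continuous_trigSum _ _).measurable.aemeasurable hsn fun x => ?_).trans
    ?_
  · rw [← (hsum x).tsum_eq]
    exact norm_tsum_le_tsum_norm (hsn x)
  · calc ∑' j, X.eNorm (w j) ≤ ∑' j, ENNReal.ofReal (2 * b j) * X.eNorm T := by
          refine ENNReal.tsum_le_tsum fun j => (X.eNorm_add_le _ _).trans ?_
          rw [X.eNorm_smul, X.eNorm_smul, hX.eNorm_translate, hX.eNorm_translate, two_mul,
            ENNReal.ofReal_add (hb0 j) (hb0 j), add_mul]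
          gcongr
          · exact henorm _ _ (hα j)
          · exact henorm _ _ (hβ j)
      _ = _ := by
          rw [ENNReal.tsum_mul_right, ← tsum_mul_left, ENNReal.ofReal_tsum_of_nonneg
            (fun j => by linarith [hb0 j]) (hb.mul_left 2)]

/-- The Fourier series of the Bernoulli polynomial `B₂` at `(u + 1) / 4` and `(u + 3) / 4`: the
quadratic parts cancel in the difference and a linear function of `u` remains. With `u = k / N` this
is a cosine series for the symbol of the derivative, with coefficients `O(1 / j ^ 2)`. -/
theorem hasSum_cos_sub_cos {u : ℝ} (hu : |u| ≤ 1) :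
    HasSum (fun j : ℕ => 1 / (j : ℝ) ^ 2 *
      (Real.cos (π * j * (u + 1) / 2) - Real.cos (π * j * (u + 3) / 2))) (-(π ^ 2 * u / 4)) := by
  obtain ⟨h1, h2⟩ := abs_le.1 hu
  have ha := hasSum_one_div_nat_pow_mul_cos (k := 1) one_ne_zero (x := (u + 1) / 4)
    ⟨by linarith, by linarith⟩
  have hb := hasSum_one_div_nat_pow_mul_cos (k := 1) one_ne_zero (x := (u + 3) / 4)
    ⟨by linarith, by linarith⟩
  have hB : ∀ x : ℝ, ((Polynomial.bernoulli 2).map (algebraMap ℚ ℝ)).eval x = x ^ 2 - x + 1 / 6 := by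
    intro x
    simp [Polynomial.bernoulli, Finset.sum_range_succ]
    ring
  refine (ha.sub hb).of_eq (fun j => ?_) ?_
  · rw [← mul_sub]
    congr 3 <;> ring_nf
  · simp only [mul_one, hB]
    norm_num [Nat.factorial]
    ring

/-- Bernstein's inequality (with a non-sharp constant). -/
theorem RearrangementInvariant.eNorm_deriv_le (hX : X.RearrangementInvariant) {N : ℕ} (hN : 1 ≤ N)
    (c : ℤ → ℂ) :
    X.eNorm (trigSum N fun k => Complex.I * k * c k) ≤ 4 * N * X.eNorm (trigSum N c) := by
  have hN0 : (N : ℝ) ≠ 0 := by positivity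
  have hN0' : (N : ℂ) ≠ 0 := by exact_mod_cast hN0
  have hpi : (π : ℂ) ≠ 0 := by exact_mod_cast Real.pi_ne_zero
  have hz : HasSum (fun j : ℕ => (N : ℝ) * (1 / (j : ℝ) ^ 2)) (N * (π ^ 2 / 6)) :=
    hasSum_zeta_two.mul_left _
  -- Each cosine splits into exponentials with signs `σ = ±1`. The phase depending on `k` is a
  -- translation by `σ π j / (2 N)`; the constant phases, from the shifts `1` and `3`, go into the
  -- coefficient.
  set ρ : ℕ → ℝ → ℂ := fun j σ => -(4 * N * Complex.I / π ^ 2) * (1 / (j : ℂ) ^ 2) / 2 *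
    (Complex.exp (Complex.I * (π * j * σ / 2)) - Complex.exp (Complex.I * (3 * π * j * σ / 2)))
    with hρ
  have hnorm : ∀ j σ, ‖ρ j σ‖ ≤ N * (1 / (j : ℝ) ^ 2) := by
    intro j σ
    have h1 : ‖Complex.exp (Complex.I * (π * j * σ / 2)) -
        Complex.exp (Complex.I * (3 * π * j * σ / 2))‖ ≤ 2 := by
      refine (norm_sub_le _ _).trans ?_
      have e1 := Complex.norm_exp_I_mul_ofReal (π * j * σ / 2)
      have e2 := Complex.norm_exp_I_mul_ofReal (3 * π * j * σ / 2)
      push_cast at e1 e2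
      rw [e1, e2]; norm_num
    have h2 : ‖-(4 * N * Complex.I / π ^ 2) * (1 / (j : ℂ) ^ 2) / 2‖
        = 4 / π ^ 2 * (N * (1 / (j : ℝ) ^ 2)) / 2 := by
      simp [abs_of_pos Real.pi_pos]; ring
    rw [hρ, norm_mul, h2]
    have h3 : 4 / π ^ 2 ≤ 1 := by
      rw [div_le_one (by positivity)]; nlinarith [Real.pi_gt_three]
    have h4 : 0 ≤ (N : ℝ) * (1 / (j : ℝ) ^ 2) := by positivity
    have h5 : 0 ≤ 4 / π ^ 2 := by positivity
    calc _ ≤ 4 / π ^ 2 * (N * (1 / (j : ℝ) ^ 2)) / 2 * 2 := by gcongr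
      _ ≤ _ := by nlinarith
  have h := hX.eNorm_multiplier_le N c (fun k => Complex.I * k) (fun j => ρ j 1)
    (fun j => ρ j (-1)) (fun j => (N : ℝ) * (1 / (j : ℝ) ^ 2)) (fun j => π * j / (2 * N))
    (fun j => hnorm j _) (fun j => hnorm j _) hz.summable ?_
  · refine h.trans ?_
    gcongr
    rw [hz.tsum_eq]
    -- The constant `4` stands for `π ^ 2 / 3`.
    have : 2 * ((N : ℝ) * (π ^ 2 / 6)) ≤ 4 * N := by
      have : π ^ 2 ≤ 12 := by nlinarith [Real.pi_lt_d2, Real.pi_pos]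
      have hN1 : (0 : ℝ) ≤ N := by positivity
      nlinarith
    refine (ENNReal.ofReal_le_ofReal this).trans ?_
    rw [ENNReal.ofReal_mul (by norm_num)]
    simp
  · intro k hk
    have hkN : |(k : ℝ) / N| ≤ 1 := by
      rw [abs_div, abs_of_pos (by positivity : (0 : ℝ) < N), div_le_one (by positivity)]
      have := abs_le.2 (Finset.mem_Icc.1 hk)
      exact_mod_cast this
    have hs := (Complex.hasSum_ofReal.2 (hasSum_cos_sub_cos hkN)).mul_left
      (-(4 * N * Complex.I / π ^ 2))
    refine hs.of_eq (fun j => ?_) ?_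
    · push_cast
      simp only [hρ, Complex.cos]
      have e : ∀ (σ a : ℂ), Complex.exp (Complex.I * (a * π * j * σ / 2)) *
          Complex.exp (Complex.I * k * (σ * (π * j / (2 * N))))
          = Complex.exp (σ * (π * j * (k / N + a) / 2 * Complex.I)) := by
        intro σ a
        rw [← Complex.exp_add]
        congr 1
        field_simp
        ring
      have e1 := e 1 1
      have e2 := e 1 3
      have e3 := e (-1) 1
      have e4 := e (-1) 3
      simp only [one_mul, neg_mul] at e1 e2 e3 e4
      simp only [neg_mul]
      rw [← e1, ← e2, ← e3, ← e4]
      push_cast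
      ring
    · push_cast
      field_simp

theorem RearrangementInvariant.eNorm_iterate_deriv_le (hX : X.RearrangementInvariant) {N : ℕ}
    (hN : 1 ≤ N) (c : ℤ → ℂ) (m : ℕ) :
    X.eNorm (trigSum N fun k => (Complex.I * k) ^ m * c k)
      ≤ (4 * N) ^ m * X.eNorm (trigSum N c) := by
  induction m with
  | zero => simp
  | succ m ih =>
    have h := hX.eNorm_deriv_le hN fun k => (Complex.I * k) ^ m * c k
    simp only [pow_succ', mul_assoc] at h ih ⊢
    exact h.trans (by gcongr)

/-- The derivative is controlled by a difference quotient with a step of order `1 / N`. -/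
theorem RearrangementInvariant.eNorm_deriv_le_difference (hX : X.RearrangementInvariant) {N : ℕ}
    (hN : 1 ≤ N) (c : ℤ → ℂ) :
    X.eNorm (trigSum N fun k => Complex.I * k * c k) ≤ 16 * N * X.eNorm (trigSum N fun k =>
      (Complex.exp (Complex.I * k * (1 / (8 * N) : ℝ)) - 1) * c k) := by
  have hNpos : (0 : ℝ) < N := by positivity
  set h : ℝ := 1 / (8 * N) with hh
  have hpos : 0 < h := by positivity
  set D : ℤ → ℂ := fun k => Complex.I * k * c k with hD
  set p := X.eNorm (trigSum N D) with hp
  have hpfin : p ≠ ∞ := (eNorm_trigSum_lt_top X N D).ne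
  set d := trigSum N (fun k => (Complex.exp (Complex.I * k * h) - 1) * c k) with hd
  -- The Taylor terms of order at least two, that is, the remainder after the first difference has
  -- been compared with `h` times the derivative.
  set u : ℕ → Torus → ℂ := fun j => ((h : ℂ) ^ (j + 2) / (j + 2).factorial) •
    trigSum N fun k => (Complex.I * k) ^ (j + 2) * c k with hu
  have hdx : ∀ x, d x = trigSum N c (x + (h : Torus)) - trigSum N c x := by
    intro x
    rw [congrFun (trigSum_translate N c h) x]
    simp only [hd, trigSum]
    rw [← Finset.sum_sub_distrib]
    exact Finset.sum_congr rfl fun k _ => by ring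
  have hsum : ∀ x, HasSum (fun j => u j x) ((d - (h : ℂ) • trigSum N D) x) := by
    intro x
    have ht := (hasSum_nat_add_iff' 2).2 (hasSum_trigSum_taylor N c x h)
    refine ht.of_eq (fun j => by simp [hu]) ?_
    simp [Finset.sum_range_succ, hdx, hD]
    ring
  have hsn : ∀ x, Summable fun j => ‖u j x‖ := fun x => (hsum x).summable.norm
  have hmeas : AEMeasurable (d - (h : ℂ) • trigSum N D) torusMeasure :=
    ((continuous_trigSum _ _).sub ((continuous_trigSum _ _).const_smul _)).measurable.aemeasurable
  have hgeo : ∑' j : ℕ, ENNReal.ofReal ((1 / 2) ^ (j + 1)) = 1 := by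
    have hs : HasSum (fun j : ℕ => (1 / 2 : ℝ) ^ (j + 1)) 1 := by
      simpa [pow_succ, div_eq_mul_inv] using hasSum_geometric_two.mul_right (1 / 2 : ℝ)
    rw [← ENNReal.ofReal_tsum_of_nonneg (fun j => by positivity) hs.summable, hs.tsum_eq]
    simp
  -- Bernstein's inequality applied to the derivative bounds the remainder by `(h / 2) * ∑ (4 N h) ^
  -- (j + 1) * p`. The step `h = 1 / (8 N)` makes the ratio `1 / 2`, so half of `h * p` survives.
  have hF : X.eNorm (d - (h : ℂ) • trigSum N D) ≤ ENNReal.ofReal (h / 2) * p := by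
    refine (X.eNorm_le_tsum _ u hmeas hsn fun x => ?_).trans ?_
    · rw [← (hsum x).tsum_eq]
      exact norm_tsum_le_tsum_norm (hsn x)
    calc ∑' j, X.eNorm (u j)
        ≤ ∑' j : ℕ, ENNReal.ofReal ((1 / 2) ^ (j + 1)) * (ENNReal.ofReal (h / 2) * p) := by
          refine ENNReal.tsum_le_tsum fun j => ?_
          rw [hu, X.eNorm_smul]
          have h1 := hX.eNorm_iterate_deriv_le hN D (j + 1)
          have h2 : (fun k : ℤ => (Complex.I * k) ^ (j + 1) * D k)
              = fun k => (Complex.I * k) ^ (j + 2) * c k := by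
            ext k; simp only [hD]; ring
          rw [h2] at h1
          have h3 : ‖(h : ℂ) ^ (j + 2) / (j + 2).factorial‖ₑ
              ≤ ENNReal.ofReal (h ^ (j + 2) / 2) := by
            rw [← ofReal_norm]
            refine ENNReal.ofReal_le_ofReal ?_
            rw [norm_div, norm_pow, Complex.norm_real, Real.norm_of_nonneg hpos.le,
              Complex.norm_natCast]
            gcongr
            exact_mod_cast (Nat.factorial_le (by lia : 2 ≤ j + 2))
          have h4 : ((4 * N : ℝ≥0∞)) ^ (j + 1) = ENNReal.ofReal ((4 * N) ^ (j + 1)) := by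
            rw [ENNReal.ofReal_pow (by positivity), ENNReal.ofReal_mul (by norm_num)]
            simp
          calc _ ≤ ENNReal.ofReal (h ^ (j + 2) / 2) * ((4 * N) ^ (j + 1) * p) := by gcongr
            _ = _ := by
              rw [h4, ← mul_assoc, ← mul_assoc, ← ENNReal.ofReal_mul (by positivity),
                ← ENNReal.ofReal_mul (by positivity)]
              congr 2
              have : 4 * (N : ℝ) * h = 1 / 2 := by rw [hh]; field_simp; norm_num
              rw [← this]; ring_nf
      _ = _ := by rw [ENNReal.tsum_mul_right, hgeo, one_mul]
  have hmain : ENNReal.ofReal h * p ≤ X.eNorm d + ENNReal.ofReal (h / 2) * p := by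
    have e : (h : ℂ) • trigSum N D = d - (d - (h : ℂ) • trigSum N D) := by simp
    have e2 : X.eNorm ((h : ℂ) • trigSum N D) = ENNReal.ofReal h * p := by
      rw [X.eNorm_smul, ← ofReal_norm, Complex.norm_real, Real.norm_of_nonneg hpos.le]
    rw [← e2, e]
    exact (X.eNorm_sub_le _ _).trans (by gcongr)
  have hhalf : ENNReal.ofReal h * p = ENNReal.ofReal (h / 2) * p + ENNReal.ofReal (h / 2) * p := by
    rw [← add_mul, ← ENNReal.ofReal_add (by positivity) (by positivity)]; simp
  rw [hhalf] at hmain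
  -- Cancelling the remainder is legitimate because a polynomial has finite norm.
  have hle : ENNReal.ofReal (h / 2) * p ≤ X.eNorm d :=
    (ENNReal.add_le_add_iff_right (ENNReal.mul_ne_top ENNReal.ofReal_ne_top hpfin)).1 hmain
  have h16 : (16 * N : ℝ≥0∞) * ENNReal.ofReal (h / 2) = 1 := by
    have : (16 * N : ℝ≥0∞) = ENNReal.ofReal (16 * N) := by
      rw [ENNReal.ofReal_mul (by norm_num)]; simp
    rw [this, ← ENNReal.ofReal_mul (by positivity)]
    have : 16 * (N : ℝ) * (h / 2) = 1 := by rw [hh]; field_simp; norm_num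
    simp [this]
  calc p = 16 * N * (ENNReal.ofReal (h / 2) * p) := by rw [← mul_assoc, h16, one_mul]
    _ ≤ _ := by gcongr

/-- The Nikolskii–Stechkin inequality. -/
theorem RearrangementInvariant.eNorm_torusDeriv_le (hX : X.RearrangementInvariant) {N : ℕ}
    (hN : 1 ≤ N) (s : ℕ) {T : Torus → ℂ} (hT : T ∈ trigPoly N) :
    X.eNorm (torusDeriv s T) ≤ (16 * N) ^ s * X.eNorm (difference s (1 / (8 * N)) T) := by
  obtain ⟨c, rfl⟩ := mem_trigPoly_iff.1 hT
  rw [torusDeriv_trigSum, difference_trigSum]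
  clear hT
  -- Multipliers commute: the first-order bound is applied to the `s`-th derivative, the induction
  -- hypothesis to the first difference of the polynomial.
  induction s generalizing c with
  | zero => simp
  | succ s ih =>
    have h1 := hX.eNorm_deriv_le_difference hN fun k => (Complex.I * k) ^ s * c k
    have h2 := ih fun k => (Complex.exp (Complex.I * k * (1 / (8 * N) : ℝ)) - 1) * c k
    have e1 : (fun k : ℤ => Complex.I * k * ((Complex.I * k) ^ s * c k))
        = fun k : ℤ => (Complex.I * k) ^ (s + 1) * c k := by ext k; ring
    have e2 : (fun k : ℤ => (Complex.exp (Complex.I * k * (1 / (8 * N) : ℝ)) - 1) *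
        ((Complex.I * k) ^ s * c k)) = fun k : ℤ => (Complex.I * k) ^ s *
        ((Complex.exp (Complex.I * k * (1 / (8 * N) : ℝ)) - 1) * c k) := by ext k; ring
    have e3 : (fun k : ℤ => (Complex.exp (Complex.I * k * (1 / (8 * N) : ℝ)) - 1) ^ s *
        ((Complex.exp (Complex.I * k * (1 / (8 * N) : ℝ)) - 1) * c k)) = fun k : ℤ =>
        (Complex.exp (Complex.I * k * (1 / (8 * N) : ℝ)) - 1) ^ (s + 1) * c k := by ext k; ring
    rw [e1, e2] at h1
    rw [e3] at h2
    rw [pow_succ', mul_assoc]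
    exact h1.trans (by gcongr)

end BanachFunctionLattice

/-! ### Step functions on arcs and their rearrangements -/

/-- The step function `∑_{k < m} a_k χ_{A_k}`. -/
noncomputable def stepFn (m : ℕ) (a : ℕ → ℝ) (A : ℕ → Set Torus) : Torus → ℂ := fun y =>
  ∑ k ∈ Finset.range m, (A k).indicator (fun _ => ((a k : ℝ) : ℂ)) y

/-- The arc `[p, q)` of the circle. -/
def arcSet (p q : ℝ) : Set Torus := (fun t : ℝ => (t : Torus)) '' Ico p q

theorem arcSet_mono {p q p' q' : ℝ} (hp : p' ≤ p) (hq : q ≤ q') : arcSet p q ⊆ arcSet p' q' :=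
  image_mono (Ico_subset_Ico hp hq)

theorem measurableSet_arcSet (p q : ℝ) : MeasurableSet (arcSet p q) := by
  rcases le_or_gt q p with h | h
  · simp [arcSet, Ico_eq_empty (not_lt.2 h)]
  · rw [arcSet, ← Ioo_insert_left h, image_insert_eq]
    have : IsOpen ((fun t : ℝ => (t : Torus)) '' Ioo p q) :=
      QuotientAddGroup.isOpenMap_coe _ isOpen_Ioo
    exact this.measurableSet.insert _

theorem measure_arcSet_add (p ℓ : ℝ) :
    torusMeasure (arcSet p (p + ℓ)) = torusMeasure (arcSet 0 ℓ) := by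
  have : arcSet p (p + ℓ) = (fun x : Torus => x + ((-p : ℝ) : Torus)) ⁻¹' arcSet 0 ℓ := by
    ext x
    constructor
    · rintro ⟨t, ht, rfl⟩
      exact ⟨t - p, ⟨by linarith [ht.1], by linarith [ht.2]⟩, by simp [sub_eq_add_neg]⟩
    · rintro ⟨t, ht, hx⟩
      refine ⟨t + p, ⟨by linarith [ht.1], by linarith [ht.2]⟩, ?_⟩
      have : ((t + p : ℝ) : Torus) = (t : Torus) + (p : Torus) := by simp
      simp only at hx
      simp only [this, hx]
      simp
  rw [this]
  exact measure_preimage_add_right torusMeasure _ _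

/-- Nondecreasing points within one period: `x_0 ≤ ⋯ ≤ x_m ≤ x_0 + 2π`. -/
structure IsCirclePartition (m : ℕ) (x : ℕ → ℝ) : Prop where
  le_succ : ∀ k < m, x k ≤ x (k + 1)
  le_period : x m ≤ x 0 + 2 * π

namespace IsCirclePartition

variable {m : ℕ} {x : ℕ → ℝ}

theorem mono (h : IsCirclePartition m x) {i j : ℕ} (hij : i ≤ j) (hj : j ≤ m) : x i ≤ x j := by
  induction j, hij using Nat.le_induction with
  | base => exact le_rfl
  | succ j _ ih => exact (ih (by lia)).trans (h.le_succ j (by lia))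

theorem disjoint (h : IsCirclePartition m x) :
    (↑(Finset.range m) : Set ℕ).PairwiseDisjoint fun k => arcSet (x k) (x (k + 1)) := by
  have hmem : ∀ k < m, Ico (x k) (x (k + 1)) ⊆ Ico (x 0) (x 0 + 2 * π) := fun k hk =>
    Ico_subset_Ico (h.mono (Nat.zero_le k) hk.le) ((h.mono hk le_rfl).trans h.le_period)
  have key : ∀ i j, i < j → j < m →
      Disjoint (arcSet (x i) (x (i + 1))) (arcSet (x j) (x (j + 1))) := by
    intro i j hij hj
    rw [Set.disjoint_left]
    rintro _ ⟨t, ht, rfl⟩ ⟨t', ht', he⟩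
    have := (AddCircle.coe_eq_coe_iff_of_mem_Ico (hmem j hj ht') (hmem i (by lia) ht)).1 he
    have h1 := h.mono (i := i + 1) (j := j) hij hj.le
    have := ht.2
    have := ht'.1
    linarith
  intro i hi j hj hij
  have hi' : i < m := by simpa using hi
  have hj' : j < m := by simpa using hj
  rcases lt_or_gt_of_ne hij with h1 | h1
  · exact key i j h1 hj'
  · exact (key j i h1 hi').symm

end IsCirclePartition

theorem stepFn_apply_of_mem {m : ℕ} {a : ℕ → ℝ} {A : ℕ → Set Torus}
    (hA : (↑(Finset.range m) : Set ℕ).PairwiseDisjoint A) {k : ℕ} (hk : k < m) {y : Torus}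
    (hy : y ∈ A k) : stepFn m a A y = a k := by
  rw [stepFn, Finset.sum_eq_single k]
  · simp [hy]
  · intro j hj hjk
    exact indicator_of_notMem
      (fun h => (Set.disjoint_left.1 (hA hj (by simpa using hk) hjk)) h hy) _
  · intro h; exact absurd (Finset.mem_range.2 hk) h

theorem stepFn_apply_of_forall_notMem {m : ℕ} {a : ℕ → ℝ} {A : ℕ → Set Torus} {y : Torus}
    (hy : ∀ k < m, y ∉ A k) : stepFn m a A y = 0 :=
  Finset.sum_eq_zero fun k hk => indicator_of_notMem (hy k (Finset.mem_range.1 hk)) _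

theorem measurable_stepFn {m : ℕ} {a : ℕ → ℝ} {A : ℕ → Set Torus}
    (hA : ∀ k < m, MeasurableSet (A k)) : Measurable (stepFn m a A) :=
  Finset.measurable_fun_sum _ fun k hk =>
    measurable_const.indicator (hA k (Finset.mem_range.1 hk))

theorem stepFn_eq_ofReal (m : ℕ) (a : ℕ → ℝ) (A : ℕ → Set Torus) (y : Torus) :
    stepFn m a A y = ((∑ k ∈ Finset.range m, (A k).indicator (fun _ => a k) y : ℝ) : ℂ) := by
  rw [stepFn, Complex.ofReal_sum]
  refine Finset.sum_congr rfl fun k _ => ?_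
  by_cases h : y ∈ A k <;> simp [h]

theorem norm_stepFn {m : ℕ} {a : ℕ → ℝ} (ha : ∀ k, 0 ≤ a k) (A : ℕ → Set Torus) (y : Torus) :
    ‖stepFn m a A y‖ = ∑ k ∈ Finset.range m, (A k).indicator (fun _ => a k) y := by
  rw [stepFn_eq_ofReal, Complex.norm_real, Real.norm_of_nonneg]
  exact Finset.sum_nonneg fun k _ => indicator_nonneg (fun _ _ => ha k) _

theorem eNorm_stepFn_lt_top (X : BanachFunctionLattice) {m : ℕ} {a : ℕ → ℝ} (ha : ∀ k, 0 ≤ a k)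
    {A : ℕ → Set Torus} (hA : ∀ k < m, MeasurableSet (A k)) : X.eNorm (stepFn m a A) < ∞ := by
  refine X.eNorm_lt_top_of_bounded (measurable_stepFn hA).aemeasurable
    (M := ∑ k ∈ Finset.range m, a k) fun y => ?_
  rw [norm_stepFn ha]
  exact Finset.sum_le_sum fun k _ => indicator_le_self' (fun _ _ => ha k) y

namespace BanachFunctionLattice

variable {X : BanachFunctionLattice}

/-- For a level `y > 0` the distribution function is the total measure of the cells with `y ≤ a k`,
hence depends only on the measures of the cells; for `y ≤ 0` the level set is the whole circle. -/
theorem RearrangementInvariant.eNorm_stepFn_eq (hX : X.RearrangementInvariant) {m : ℕ} {a : ℕ → ℝ}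
    (ha : ∀ k, 0 ≤ a k) {A B : ℕ → Set Torus}
    (hA : (↑(Finset.range m) : Set ℕ).PairwiseDisjoint A)
    (hB : (↑(Finset.range m) : Set ℕ).PairwiseDisjoint B)
    (hAm : ∀ k < m, MeasurableSet (A k)) (hBm : ∀ k < m, MeasurableSet (B k))
    (hAB : ∀ k < m, torusMeasure (A k) = torusMeasure (B k)) :
    X.eNorm (stepFn m a A) = X.eNorm (stepFn m a B) := by
  have key : ∀ C : ℕ → Set Torus, (↑(Finset.range m) : Set ℕ).PairwiseDisjoint C →
      (∀ k < m, MeasurableSet (C k)) → ∀ y : ℝ, 0 < y →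
      torusMeasure {x | y ≤ ‖stepFn m a C x‖}
        = ∑ k ∈ (Finset.range m).filter (fun k => y ≤ a k), torusMeasure (C k) := by
    intro C hC hCm y hy
    have : {x | y ≤ ‖stepFn m a C x‖}
        = ⋃ k ∈ (Finset.range m).filter (fun k => y ≤ a k), C k := by
      ext x
      simp only [mem_ofPred_eq, mem_iUnion, Finset.mem_filter, Finset.mem_range, exists_prop]
      constructor
      · intro h
        by_cases hx : ∀ k < m, x ∉ C k
        · rw [stepFn_apply_of_forall_notMem hx] at h
          simp at h; linarith
        · push Not at hx
          obtain ⟨k, hk, hxk⟩ := hx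
          rw [stepFn_apply_of_mem hC hk hxk, Complex.norm_real, Real.norm_of_nonneg (ha k)] at h
          exact ⟨k, ⟨hk, h⟩, hxk⟩
      · rintro ⟨k, ⟨hk, h⟩, hxk⟩
        rwa [stepFn_apply_of_mem hC hk hxk, Complex.norm_real, Real.norm_of_nonneg (ha k)]
    rw [this]
    refine measure_biUnion_finset (hC.subset ?_) fun k hk => hCm k ?_
    · exact_mod_cast Finset.filter_subset _ _
    · exact Finset.mem_range.1 (Finset.mem_filter.1 hk).1
  refine hX _ _ (measurable_stepFn hAm).aemeasurable (measurable_stepFn hBm).aemeasurable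
    fun y => ?_
  rcases le_or_gt y 0 with hy | hy
  · have : ∀ f : Torus → ℂ, {x | y ≤ ‖f x‖} = univ := fun f =>
      eq_univ_of_forall fun x => hy.trans (norm_nonneg _)
    rw [this, this]
  · rw [key A hA hAm y hy, key B hB hBm y hy]
    exact Finset.sum_congr rfl fun k hk => hAB k (Finset.mem_range.1 (Finset.mem_filter.1 hk).1)

/-- Step functions with the same coefficients on disjoint arcs of the same length have the same
norm. -/
theorem RearrangementInvariant.eNorm_stepFn_arcSet_eq (hX : X.RearrangementInvariant) {m : ℕ}
    {a : ℕ → ℝ} (ha : ∀ k, 0 ≤ a k) {x x' u u' : ℕ → ℝ} {ℓ : ℝ} (hx : IsCirclePartition m x)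
    (hx' : IsCirclePartition m x') (hu : ∀ k < m, x k ≤ u k) (hu' : ∀ k < m, x' k ≤ u' k)
    (hv : ∀ k < m, u k + ℓ ≤ x (k + 1)) (hv' : ∀ k < m, u' k + ℓ ≤ x' (k + 1)) :
    X.eNorm (stepFn m a fun k => arcSet (u k) (u k + ℓ))
      = X.eNorm (stepFn m a fun k => arcSet (u' k) (u' k + ℓ)) := by
  have hd : ∀ {z w : ℕ → ℝ}, IsCirclePartition m z → (∀ k < m, z k ≤ w k) →
      (∀ k < m, w k + ℓ ≤ z (k + 1)) →
      (↑(Finset.range m) : Set ℕ).PairwiseDisjoint fun k => arcSet (w k) (w k + ℓ) := by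
    intro z w hz h1 h2 i hi j hj hij
    have hi' : i < m := by simpa using hi
    have hj' : j < m := by simpa using hj
    exact (hz.disjoint hi hj hij).mono (arcSet_mono (h1 i hi') (h2 i hi'))
      (arcSet_mono (h1 j hj') (h2 j hj'))
  refine hX.eNorm_stepFn_eq ha (hd hx hu hv) (hd hx' hu' hv')
    (fun k _ => measurableSet_arcSet _ _) (fun k _ => measurableSet_arcSet _ _) fun k _ => ?_
  rw [measure_arcSet_add, measure_arcSet_add]

/-- Lengthening the arcs by a factor of at most `J` increases the norm by at most this factor. -/
theorem RearrangementInvariant.eNorm_stepFn_arcSet_le (hX : X.RearrangementInvariant) {m : ℕ}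
    {a : ℕ → ℝ} (ha : ∀ k, 0 ≤ a k) {x : ℕ → ℝ} {ℓ : ℝ} (hℓ : 0 < ℓ) (hx : IsCirclePartition m x)
    (J : ℕ) (hlow : ∀ k < m, ℓ ≤ x (k + 1) - x k) (hup : ∀ k < m, x (k + 1) - x k ≤ J * ℓ) :
    X.eNorm (stepFn m a fun k => arcSet (x k) (x (k + 1)))
      ≤ J * X.eNorm (stepFn m a fun k => arcSet (x k) (x k + ℓ)) := by
  -- The `j`-th family shifts every short arc by `j * ℓ`, stopped so that it stays inside its cell.
  -- Each family is then disjoint and has the norm of the unshifted one, and `J` families cover all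
  -- cells.
  set u : ℕ → ℕ → ℝ := fun j k => min (x k + j * ℓ) (x (k + 1) - ℓ) with hu
  have hu1 : ∀ j, ∀ k < m, x k ≤ u j k := fun j k hk =>
    le_min (by have : 0 ≤ (j : ℝ) * ℓ := by positivity
               linarith) (by linarith [hlow k hk])
  have hu2 : ∀ j, ∀ k < m, u j k + ℓ ≤ x (k + 1) := fun j k hk => by
    linarith [min_le_right (x k + j * ℓ) (x (k + 1) - ℓ)]
  have heq : ∀ j, X.eNorm (stepFn m a fun k => arcSet (u j k) (u j k + ℓ))
      = X.eNorm (stepFn m a fun k => arcSet (x k) (x k + ℓ)) := fun j =>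
    hX.eNorm_stepFn_arcSet_eq ha hx hx (hu1 j) (fun k _ => le_rfl) (hu2 j)
      (fun k hk => by linarith [hlow k hk])
  have hcover : ∀ k < m, ∀ y ∈ arcSet (x k) (x (k + 1)),
      ∃ j ∈ Finset.range J, y ∈ arcSet (u j k) (u j k + ℓ) := by
    rintro k hk _ ⟨t, ht, rfl⟩
    set j := ⌊(t - x k) / ℓ⌋₊ with hj
    have h0 : 0 ≤ (t - x k) / ℓ := div_nonneg (by linarith [ht.1]) hℓ.le
    have h1 : (j : ℝ) * ℓ ≤ t - x k := (le_div_iff₀ hℓ).1 (Nat.floor_le h0)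
    have h2 : t - x k < (j + 1) * ℓ := (div_lt_iff₀ hℓ).1 (Nat.lt_floor_add_one _)
    refine ⟨j, Finset.mem_range.2 ?_, ⟨t, ⟨?_, ?_⟩, rfl⟩⟩
    · have : (j : ℝ) * ℓ < J * ℓ := by linarith [hup k hk, ht.2]
      exact_mod_cast lt_of_mul_lt_mul_right this hℓ.le
    · exact (min_le_left _ _).trans (by linarith)
    · rcases min_choice (x k + j * ℓ) (x (k + 1) - ℓ) with h | h
      · simp only [hu, h]; linarith
      · simp only [hu, h]; linarith [ht.2]
  have hm : ∀ w : ℕ → ℝ, ∀ k < m, MeasurableSet (arcSet (w k) (w k + ℓ)) := fun w k _ =>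
    measurableSet_arcSet _ _
  calc X.eNorm (stepFn m a fun k => arcSet (x k) (x (k + 1)))
      ≤ X.eNorm (∑ j ∈ Finset.range J, stepFn m a fun k => arcSet (u j k) (u j k + ℓ)) := by
        refine X.eNorm_mono _ _ (measurable_stepFn fun k _ =>
          measurableSet_arcSet _ _).aemeasurable ?_ fun y => ?_
        · exact (X.eNorm_sum_le _ _).trans_lt
            (ENNReal.sum_lt_top.2 fun j _ => eNorm_stepFn_lt_top X ha (hm _))
        · have hR : (∑ j ∈ Finset.range J, stepFn m a fun k => arcSet (u j k) (u j k + ℓ)) y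
              = ((∑ j ∈ Finset.range J, ∑ k ∈ Finset.range m,
                (arcSet (u j k) (u j k + ℓ)).indicator (fun _ => a k) y : ℝ) : ℂ) := by
            simp [stepFn_eq_ofReal]
          have hpos : ∀ j k, 0 ≤ (arcSet (u j k) (u j k + ℓ)).indicator (fun _ => a k) y :=
            fun j k => indicator_nonneg (fun _ _ => ha k) _
          rw [norm_stepFn ha, hR, Complex.norm_real, Real.norm_of_nonneg
            (Finset.sum_nonneg fun j _ => Finset.sum_nonneg fun k _ => hpos j k), Finset.sum_comm]
          refine Finset.sum_le_sum fun k hk => ?_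
          by_cases hy : y ∈ arcSet (x k) (x (k + 1))
          · obtain ⟨j, hj, hyj⟩ := hcover k (Finset.mem_range.1 hk) y hy
            refine le_trans ?_ (Finset.single_le_sum (fun j _ => hpos j k) hj)
            simp [hy, hyj]
          · rw [indicator_of_notMem hy]
            exact Finset.sum_nonneg fun j _ => hpos j k
    _ ≤ ∑ j ∈ Finset.range J, X.eNorm (stepFn m a fun k => arcSet (u j k) (u j k + ℓ)) :=
        X.eNorm_sum_le _ _
    _ = _ := by simp [heq]

end BanachFunctionLattice

/-! ### Marcinkiewicz–Zygmund inequality and the effect of dilation -/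

namespace BanachFunctionLattice

variable {X : BanachFunctionLattice}

/-- Upper Marcinkiewicz–Zygmund inequality for arcs of length `δ` that are disjoint. -/
theorem RearrangementInvariant.eNorm_stepFn_samples_le (hX : X.RearrangementInvariant) {N : ℕ}
    (hN : 1 ≤ N) {T : Torus → ℂ} (hT : T ∈ trigPoly N) {m : ℕ} {x : ℕ → ℝ} {δ : ℝ} (hδ : 0 ≤ δ)
    (hx : IsCirclePartition m x) (hgap : ∀ k < m, x k + δ ≤ x (k + 1)) :
    X.eNorm (stepFn m (fun k => ‖T (x k : Torus)‖) fun k => arcSet (x k) (x k + δ))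
      ≤ ENNReal.ofReal (Real.exp (4 * N * δ)) * X.eNorm T := by
  obtain ⟨c, rfl⟩ := mem_trigPoly_iff.1 hT
  set D : ℕ → Torus → ℂ := fun j => trigSum N fun k => (Complex.I * k) ^ j * c k with hD
  set u : ℕ → Torus → ℂ := fun j => ((δ : ℂ) ^ j / j.factorial) • D j with hu
  have hdisj : (↑(Finset.range m) : Set ℕ).PairwiseDisjoint fun k => arcSet (x k) (x k + δ) := by
    intro i hi j hj hij
    exact (hx.disjoint hi hj hij).mono (arcSet_mono le_rfl (hgap i (by simpa using hi)))
      (arcSet_mono le_rfl (hgap j (by simpa using hj)))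
  have hsn : ∀ y, Summable fun j => ‖u j y‖ := fun y => by
    have := (hasSum_trigSum_taylor N c y δ).summable.norm
    simpa [hu, hD] using this
  have hun : ∀ j y, ‖u j y‖ = δ ^ j / j.factorial * ‖D j y‖ := fun j y => by
    simp [hu, abs_of_nonneg hδ]
  refine (X.eNorm_le_tsum _ u (measurable_stepFn fun k _ =>
    measurableSet_arcSet _ _).aemeasurable hsn fun y => ?_).trans ?_
  · by_cases hy : ∀ k < m, y ∉ arcSet (x k) (x k + δ)
    · rw [stepFn_apply_of_forall_notMem hy, norm_zero]
      exact tsum_nonneg fun _ => norm_nonneg _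
    · push Not at hy
      obtain ⟨k, hk, hyk⟩ := hy
      rw [stepFn_apply_of_mem hdisj hk hyk, Complex.norm_real, norm_norm]
      obtain ⟨t, ht, rfl⟩ := hyk
      -- The expansion is centred at the running point `t`, not at the node, so that the derivatives
      -- appear as functions of `t` and their norms in `X` can be taken.
      have htay := hasSum_trigSum_taylor N c (t : Torus) (-(t - x k))
      have he : (t : Torus) + ((-(t - x k) : ℝ) : Torus) = (x k : Torus) := by
        rw [← AddCircle.coe_add]; congr 1; ring
      rw [he] at htay
      rw [← htay.tsum_eq]
      have hs := htay.summable.norm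
      refine (norm_tsum_le_tsum_norm hs).trans (hs.tsum_le_tsum (fun j => ?_) (hsn _))
      rw [hun, norm_mul, norm_div, norm_pow, Complex.norm_real, Complex.norm_natCast, norm_neg,
        Real.norm_of_nonneg (by linarith [ht.1])]
      have : t - x k ≤ δ := by linarith [ht.2]
      have h0 : 0 ≤ t - x k := by linarith [ht.1]
      gcongr
  · have hterm : ∀ j, X.eNorm (u j)
        ≤ ENNReal.ofReal ((4 * N * δ) ^ j / j.factorial) * X.eNorm (trigSum N c) := by
      intro j
      rw [hu, X.eNorm_smul]
      have h4 : ((4 * N : ℝ≥0∞)) ^ j = ENNReal.ofReal ((4 * N) ^ j) := by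
        rw [ENNReal.ofReal_pow (by positivity), ENNReal.ofReal_mul (by norm_num)]
        simp
      have h5 : ‖(δ : ℂ) ^ j / j.factorial‖ₑ = ENNReal.ofReal (δ ^ j / j.factorial) := by
        rw [← ofReal_norm, norm_div, norm_pow, Complex.norm_real, Complex.norm_natCast,
          Real.norm_of_nonneg hδ]
      calc _ ≤ ENNReal.ofReal (δ ^ j / j.factorial) * ((4 * N) ^ j * X.eNorm (trigSum N c)) := by
            rw [h5]
            gcongr
            exact hX.eNorm_iterate_deriv_le hN c j
        _ = _ := by
            rw [h4, ← mul_assoc, ← ENNReal.ofReal_mul (by positivity)]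
            congr 2
            ring
    refine (ENNReal.tsum_le_tsum hterm).trans ?_
    rw [ENNReal.tsum_mul_right]
    have hexp := NormedSpace.expSeries_div_hasSum_exp (4 * N * δ : ℝ)
    rw [← Real.exp_eq_exp_ℝ] at hexp
    rw [← ENNReal.ofReal_tsum_of_nonneg (fun j => by positivity) hexp.summable, hexp.tsum_eq]

/-- Adjacent arcs starting at `-π` are shrunk by `t ↦ r t` onto adjacent arcs starting at `-r π`, so
the first step function is dominated by the dilation of the second. The bound `m * ℓ ≤ 2 * π` keeps
the long arcs within the fundamental interval `[-π, π)`. -/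
theorem eNorm_stepFn_le_dilationNorm {m : ℕ} {a : ℕ → ℝ} (ha : ∀ k, 0 ≤ a k) {r ℓ : ℝ}
    (hr : 0 < r) (hℓ : 0 ≤ ℓ) (hm : m * ℓ ≤ 2 * π) (hD : X.dilationNorm r ≠ ∞) :
    X.eNorm (stepFn m a fun k => arcSet (-π + k * ℓ) (-π + k * ℓ + ℓ)) ≤ X.dilationNorm r *
      X.eNorm (stepFn m a fun k =>
        arcSet (-(r * π) + k * (r * ℓ)) (-(r * π) + k * (r * ℓ) + r * ℓ)) := by
  set g := stepFn m a fun k =>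
    arcSet (-(r * π) + k * (r * ℓ)) (-(r * π) + k * (r * ℓ) + r * ℓ) with hg
  have hgfin : X.eNorm g < ∞ := eNorm_stepFn_lt_top X ha fun k _ => measurableSet_arcSet _ _
  have hdil := eNorm_dilation_le hD hgfin.ne
  refine (X.eNorm_mono _ _ (measurable_stepFn fun k _ => measurableSet_arcSet _ _).aemeasurable
    (hdil.trans_lt (ENNReal.mul_lt_top hD.lt_top hgfin)) fun y => ?_).trans hdil
  obtain ⟨t, ht, rfl⟩ := AddCircle.coe_image_Ico_eq (2 * π) (-π) ▸ mem_univ y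
  rw [dilation, AddCircle.liftIco_coe_apply ht, hg, norm_stepFn ha, norm_stepFn ha]
  refine Finset.sum_le_sum fun k hk => ?_
  have hk' : (k : ℝ) + 1 ≤ m := by exact_mod_cast Finset.mem_range.1 hk
  by_cases hy : (t : Torus) ∈ arcSet (-π + k * ℓ) (-π + k * ℓ + ℓ)
  · have hy' : ((r * t : ℝ) : Torus)
        ∈ arcSet (-(r * π) + k * (r * ℓ)) (-(r * π) + k * (r * ℓ) + r * ℓ) := by
      obtain ⟨t', ht', he⟩ := hy
      have hmem : t' ∈ Ico (-π) (-π + 2 * π) := by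
        have h1 : 0 ≤ (k : ℝ) * ℓ := by positivity
        have h2 : ((k : ℝ) + 1) * ℓ ≤ m * ℓ := by gcongr
        exact ⟨by linarith [ht'.1], by linarith [ht'.2]⟩
      have := (AddCircle.coe_eq_coe_iff_of_mem_Ico hmem ht).1 he
      subst this
      refine ⟨r * t', ⟨?_, ?_⟩, rfl⟩
      · have := mul_le_mul_of_nonneg_left ht'.1 hr.le
        linarith
      · have := mul_lt_mul_of_pos_left ht'.2 hr
        linarith
    rw [indicator_of_mem hy, indicator_of_mem hy']
  · rw [indicator_of_notMem hy]
    exact indicator_nonneg (fun _ _ => ha k) _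

end BanachFunctionLattice

namespace SamplingFamily

variable {X : BanachFunctionLattice} (G : SamplingFamily X)

theorem isCirclePartition {n : ℕ} (hn : 1 ≤ n) : IsCirclePartition (G.m n) (G.node n) where
  le_succ k hk := by
    have h1 := G.gap_lower n hn k hk
    have h2 : 0 ≤ G.γ / n := div_nonneg G.γ_pos.le (by positivity)
    linarith
  le_period := by rw [G.node_period n hn]; linarith

theorem m_mul_le {n : ℕ} (hn : 1 ≤ n) : G.m n * (G.γ / n) ≤ 2 * π := by
  have h : ∀ j ≤ G.m n, j * (G.γ / n) ≤ G.node n j - G.node n 0 := by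
    intro j
    induction j with
    | zero => simp
    | succ j ih =>
      intro hj
      have h1 := ih (by lia)
      have h2 := G.gap_lower n hn j (by lia)
      push_cast
      linarith
  have := h _ le_rfl
  rw [G.node_period n hn] at this
  linarith

theorem m_pos {n : ℕ} (hn : 1 ≤ n) : 0 < G.m n := by
  rcases Nat.eq_zero_or_pos (G.m n) with h | h
  · have := G.node_period n hn
    rw [h] at this
    linarith [Real.pi_pos]
  · exact h

theorem step_eq_stepFn (n : ℕ) (f : Torus → ℂ) :
    G.step n f = stepFn (G.m n) (fun k => ‖f (G.node n k : Torus)‖)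
      fun k => arcSet (G.node n k) (G.node n (k + 1)) := rfl

/-- The constant in the comparison of the discrete and the continuous norms. -/
noncomputable def samplingConst : ℝ≥0∞ :=
  ⌈G.γ' / G.γ⌉₊ * ENNReal.ofReal (Real.exp (4 * G.γ))

theorem samplingConst_ne_top : G.samplingConst ≠ ∞ :=
  ENNReal.mul_ne_top (ENNReal.natCast_ne_top _) ENNReal.ofReal_ne_top

/-- The arcs pass from the nodes to length `ℓ = γ / n`, and then to length `r * ℓ`, where the
samples are controlled since `4 * (2 ^ ν * n) * (r * ℓ) = 4 * γ`. The passage from `ℓ` to `r * ℓ`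
costs either the dilation norm or, by covering with `2 ^ ν` shifts, the factor `2 ^ ν`. The second
alternative is finite in any case and controls the tolerances in the choice of near-best
polynomials. -/
theorem discreteNorm_trigPoly_le (hX : X.RearrangementInvariant) {n : ℕ} (hn : 1 ≤ n) (ν : ℕ)
    {T : Torus → ℂ} (hT : T ∈ trigPoly (2 ^ ν * n)) :
    G.discreteNorm n T
      ≤ G.samplingConst * (min (X.dilationNorm ((1 / 2) ^ ν)) (2 ^ ν) * X.eNorm T) := by
  set m := G.m n
  set x := G.node n
  set a : ℕ → ℝ := fun k => ‖T (x k : Torus)‖ with ha_def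
  have ha : ∀ k, 0 ≤ a k := fun k => norm_nonneg _
  have hn0 : (0 : ℝ) < n := by positivity
  set ℓ : ℝ := G.γ / n with hℓ_def
  have hℓ : 0 < ℓ := div_pos G.γ_pos hn0
  set r : ℝ := (1 / 2) ^ ν with hr_def
  have hr : 0 < r := by positivity
  have hr1 : r ≤ 1 := pow_le_one₀ (by norm_num) (by norm_num)
  have hrℓ : r * ℓ ≤ ℓ := mul_le_of_le_one_left hℓ.le hr1
  have hr2 : (2 : ℝ) ^ ν * r = 1 := by rw [hr_def, ← mul_pow]; norm_num
  have hx : IsCirclePartition m x := G.isCirclePartition hn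
  have hgap : ∀ k < m, ℓ ≤ x (k + 1) - x k := G.gap_lower n hn
  have hmℓ : m * ℓ ≤ 2 * π := G.m_mul_le hn
  set z : ℕ → ℝ := fun k => -π + k * ℓ with hz_def
  have hz : IsCirclePartition m z :=
    ⟨fun k _ => by simp only [hz_def]; push_cast; linarith, by simp only [hz_def]; simp; linarith⟩
  have hzs : ∀ k, z k + ℓ = z (k + 1) := fun k => by simp only [hz_def]; push_cast; ring
  set w : ℕ → ℝ := fun k => -(r * π) + k * (r * ℓ) with hw_def
  have hw : IsCirclePartition m w := by
    refine ⟨fun k _ => ?_, ?_⟩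
    · simp only [hw_def]; push_cast
      have := mul_pos hr hℓ
      linarith
    · simp only [hw_def]
      have : r * (m * ℓ) ≤ 1 * (2 * π) := by gcongr
      simp; linarith
  have hws : ∀ k, w k + r * ℓ = w (k + 1) := fun k => by simp only [hw_def]; push_cast; ring
  -- from the arcs between the nodes to arcs of length `ℓ`
  have h1 : G.discreteNorm n T
      ≤ ⌈G.γ' / G.γ⌉₊ * X.eNorm (stepFn m a fun k => arcSet (x k) (x k + ℓ)) := by
    refine hX.eNorm_stepFn_arcSet_le ha hℓ hx _ hgap fun k hk => ?_
    refine (G.gap_upper n hn k hk).trans ?_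
    rw [hℓ_def, ← mul_div_assoc]
    gcongr
    exact (div_le_iff₀ G.γ_pos).1 (Nat.le_ceil _)
  have h2 : X.eNorm (stepFn m a fun k => arcSet (x k) (x k + ℓ))
      = X.eNorm (stepFn m a fun k => arcSet (z k) (z k + ℓ)) :=
    hX.eNorm_stepFn_arcSet_eq ha hx hz (fun _ _ => le_rfl) (fun _ _ => le_rfl)
      (fun k hk => by linarith [hgap k hk]) (fun k _ => (hzs k).le)
  -- from arcs of length `ℓ` to arcs of length `r * ℓ`
  set e := X.eNorm (stepFn m a fun k => arcSet (x k) (x k + r * ℓ)) with he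
  have h3 : X.eNorm (stepFn m a fun k => arcSet (z k) (z k + ℓ)) ≤ 2 ^ ν * e := by
    have := hX.eNorm_stepFn_arcSet_le ha (mul_pos hr hℓ) hz (2 ^ ν)
      (fun k _ => by rw [← hzs]; linarith)
      (fun k _ => by
        rw [← hzs]; push_cast; rw [← mul_assoc, hr2]; linarith)
    have hze : X.eNorm (stepFn m a fun k => arcSet (z k) (z k + r * ℓ)) = e :=
      hX.eNorm_stepFn_arcSet_eq ha hz hx (fun _ _ => le_rfl) (fun _ _ => le_rfl)
        (fun k _ => by rw [← hzs]; linarith) (fun k hk => by linarith [hgap k hk])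
    simp only [← hzs] at this
    rw [hze] at this
    exact_mod_cast this
  have h4 : X.eNorm (stepFn m a fun k => arcSet (z k) (z k + ℓ))
      ≤ min (X.dilationNorm r) (2 ^ ν) * e := by
    rcases eq_or_ne (X.dilationNorm r) ∞ with hD | hD
    · rwa [hD, min_eq_right le_top]
    · have hd := BanachFunctionLattice.eNorm_stepFn_le_dilationNorm (X := X) ha hr hℓ.le hmℓ hD
      have hwe : X.eNorm (stepFn m a fun k => arcSet (w k) (w k + r * ℓ)) = e :=
        hX.eNorm_stepFn_arcSet_eq ha hw hx (fun _ _ => le_rfl) (fun _ _ => le_rfl)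
          (fun k _ => (hws k).le) (fun k hk => by linarith [hgap k hk])
      rw [hwe] at hd
      rcases min_choice (X.dilationNorm r) (2 ^ ν) with h | h <;> rw [h]
      exacts [hd, h3]
  have h5 : e ≤ ENNReal.ofReal (Real.exp (4 * G.γ)) * X.eNorm T := by
    have := hX.eNorm_stepFn_samples_le (N := 2 ^ ν * n) (Nat.mul_pos (by positivity) hn) hT
      (mul_pos hr hℓ).le hx (fun k hk => by linarith [hgap k hk])
    have hN : 4 * ((2 ^ ν * n : ℕ) : ℝ) * (r * ℓ) = 4 * G.γ := by
      push_cast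
      rw [hℓ_def]
      field_simp
      linear_combination G.γ * hr2
    rwa [hN] at this
  calc G.discreteNorm n T ≤ _ := h1
    _ ≤ ⌈G.γ' / G.γ⌉₊ * (min (X.dilationNorm r) (2 ^ ν) *
        (ENNReal.ofReal (Real.exp (4 * G.γ)) * X.eNorm T)) := by
      rw [h2]
      gcongr
      exact h4.trans (by gcongr)
    _ = _ := by rw [samplingConst]; ring

end SamplingFamily

/-! ### Pointwise convergence of the telescoping series and the error decomposition -/

namespace SamplingFamily

variable {X : BanachFunctionLattice} (G : SamplingFamily X)

theorem op_sub (n : ℕ) (f g : Torus → ℂ) : G.op n (f - g) = G.op n f - G.op n g := by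
  ext x; simp [op, sub_mul]

theorem eNorm_indicator_arc_ne_zero {n : ℕ} (hn : 1 ≤ n) :
    X.eNorm ((G.arc n 0).indicator fun _ => 1) ≠ 0 := by
  have hlt : G.node n 0 < G.node n 1 := by
    have h1 := G.gap_lower n hn 0 (G.m_pos hn)
    have h2 : 0 < G.γ / n := div_pos G.γ_pos (by positivity)
    simp only [zero_add] at h1
    linarith
  have hmeas : MeasurableSet (G.arc n 0) := measurableSet_arcSet _ _
  refine X.eNorm_pos (X.indicator_mem _ hmeas.nullMeasurableSet) ?_
  have he : ∀ x, ‖(G.arc n 0).indicator (fun _ => (1 : ℂ)) x‖ₑ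
      = (G.arc n 0).indicator (fun _ => (1 : ℝ≥0∞)) x := by
    intro x; by_cases hx : x ∈ G.arc n 0 <;> simp [hx]
  simp only [he]
  rw [lintegral_indicator hmeas, setLIntegral_one]
  have hopen : IsOpen ((fun t : ℝ => (t : Torus)) '' Ioo (G.node n 0) (G.node n 1)) :=
    QuotientAddGroup.isOpenMap_coe _ isOpen_Ioo
  have hpos := hopen.measure_pos torusMeasure ((nonempty_Ioo.2 hlt).image _)
  exact (hpos.trans_le (measure_mono (image_mono Ioo_subset_Ico_self))).ne'

/-- A Nikolskii-type inequality for trigonometric polynomials. -/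
theorem enorm_trigPoly_mul_le (hX : X.RearrangementInvariant) {n : ℕ} (hn : 1 ≤ n) (ν : ℕ)
    {T : Torus → ℂ} (hT : T ∈ trigPoly (2 ^ ν * n)) (x : Torus) :
    ‖T x‖ₑ * X.eNorm ((G.arc n 0).indicator fun _ => 1)
      ≤ G.samplingConst * (min (X.dilationNorm ((1 / 2) ^ ν)) (2 ^ ν) * X.eNorm T) := by
  obtain ⟨t, rfl⟩ := QuotientAddGroup.mk_surjective x
  -- A translation moves the given point to the first node; one summand of the step function of `T'`
  -- already carries the value of `T` there.
  set T' : Torus → ℂ := fun y => T (y + ((t - G.node n 0 : ℝ) : Torus)) with hT'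
  have hmem : T' ∈ trigPoly (2 ^ ν * n) := by
    obtain ⟨c, rfl⟩ := mem_trigPoly_iff.1 hT
    rw [hT', trigSum_translate]
    exact mem_trigPoly_iff.2 ⟨_, rfl⟩
  have h := G.discreteNorm_trigPoly_le hX hn ν hmem
  rw [hX.eNorm_translate] at h
  refine le_trans ?_ h
  have hmeas : MeasurableSet (G.arc n 0) := measurableSet_arcSet _ _
  have hnode : T' (G.node n 0 : Torus) = T (t : Torus) := by
    simp only [hT', ← AddCircle.coe_add]
    congr 2; ring
  rw [← X.eNorm_smul, discreteNorm, step_eq_stepFn]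
  refine X.eNorm_mono _ _ ?_ (eNorm_stepFn_lt_top X (fun _ => norm_nonneg _)
    fun k _ => measurableSet_arcSet _ _) fun y => ?_
  · exact ((measurable_const.indicator hmeas).const_smul _).aemeasurable
  · rw [norm_stepFn fun _ => norm_nonneg _]
    refine le_trans ?_ (Finset.single_le_sum (fun k _ => indicator_nonneg
      (fun _ _ => norm_nonneg _) _) (Finset.mem_range.2 (G.m_pos hn)))
    by_cases hy : y ∈ G.arc n 0
    · have hy' : y ∈ arcSet (G.node n 0) (G.node n (0 + 1)) := hy
      rw [indicator_of_mem hy']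
      simp [hy, hnode]
    · rw [Pi.smul_apply, indicator_of_notMem hy]
      simp only [smul_zero, norm_zero]
      exact indicator_nonneg (fun _ _ => norm_nonneg _) _

/-- A function that represents its class continuously is the everywhere convergent sum of a rapidly
convergent sequence of trigonometric polynomials. -/
theorem hasSum_of_tendsto (G : SamplingFamily X) (hX : X.RearrangementInvariant) {n : ℕ} (hn : 1 ≤ n) {f : Torus → ℂ}
    (hf : X.Mem f) (hrep : IsContinuousRepresentative f) {T : ℕ → Torus → ℂ}
    (hT : ∀ ν, T ν ∈ trigPoly (2 ^ ν * n)) (hlim : Tendsto (fun ν => X.eNorm (f - T ν)) atTop (𝓝 0))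
    (hsum : ∑' ν, min (X.dilationNorm ((1 / 2) ^ (ν + 1))) (2 ^ (ν + 1)) *
      X.eNorm (T (ν + 1) - T ν) ≠ ∞) (x : Torus) :
    Summable (fun ν => ‖(T (ν + 1) - T ν) x‖) ∧
      HasSum (fun ν => (T (ν + 1) - T ν) x) ((f - T 0) x) := by
  set κ := X.eNorm ((G.arc n 0).indicator fun _ => 1)
  have hκ0 : κ ≠ 0 := G.eNorm_indicator_arc_ne_zero hn
  have hκ : κ ≠ ∞ := (X.indicator_mem _ (measurableSet_arcSet _ _).nullMeasurableSet).ne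
  set β : ℕ → ℝ≥0∞ := fun ν => κ⁻¹ * (G.samplingConst *
    (min (X.dilationNorm ((1 / 2) ^ (ν + 1))) (2 ^ (ν + 1)) * X.eNorm (T (ν + 1) - T ν))) with hβ
  have hβsum : ∑' ν, β ν ≠ ∞ := by
    rw [hβ, ENNReal.tsum_mul_left, ENNReal.tsum_mul_left]
    exact ENNReal.mul_ne_top (ENNReal.inv_ne_top.2 hκ0)
      (ENNReal.mul_ne_top G.samplingConst_ne_top hsum)
  have hTc : ∀ ν, Continuous (T ν) := fun ν => by
    obtain ⟨c, hc⟩ := mem_trigPoly_iff.1 (hT ν)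
    rw [hc]; exact continuous_trigSum _ _
  have hβle : ∀ ν y, ‖(T (ν + 1) - T ν) y‖ ≤ (β ν).toReal := by
    intro ν y
    have hmem : T (ν + 1) - T ν ∈ trigPoly (2 ^ (ν + 1) * n) :=
      Submodule.sub_mem _ (hT _) (trigPoly_mono (by gcongr <;> lia) (hT ν))
    have h := G.enorm_trigPoly_mul_le hX hn (ν + 1) hmem y
    have h' : ‖(T (ν + 1) - T ν) y‖ₑ ≤ β ν := by
      simp only [hβ]
      rw [mul_comm κ⁻¹, ← div_eq_mul_inv]
      exact (ENNReal.le_div_iff_mul_le (Or.inl hκ0) (Or.inl hκ)).2 h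
    rw [← toReal_enorm]
    exact ENNReal.toReal_mono (ENNReal.ne_top_of_tsum_ne_top hβsum ν) h'
  have hbs : Summable fun ν => (β ν).toReal := ENNReal.summable_toReal hβsum
  have hsn : ∀ y, Summable fun ν => ‖(T (ν + 1) - T ν) y‖ := fun y =>
    Summable.of_nonneg_of_le (fun _ => norm_nonneg _) (fun ν => hβle ν y) hbs
  set g : Torus → ℂ := fun y => T 0 y + ∑' ν, (T (ν + 1) - T ν) y with hg
  have hgc : Continuous g :=
    (hTc 0).add (continuous_tsum (fun ν => (hTc _).sub (hTc _)) hbs hβle)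
  have hTg : ∀ y, Tendsto (fun ν => T ν y) atTop (𝓝 (g y)) := by
    intro y
    have h := (hsn y).of_norm.hasSum.tendsto_sum_nat.const_add (T 0 y)
    refine h.congr fun ν => ?_
    simp only [Pi.sub_apply]
    rw [Finset.sum_range_sub (fun ν => T ν y)]
    ring
  have hfm := X.aemeasurable_of_mem f hf
  -- The embedding of `X` into `L¹` makes the integrals of `|f - T ν|` tend to zero, and Fatou's
  -- lemma identifies the pointwise limit.
  have hae : f =ᵐ[torusMeasure] g := by
    obtain ⟨c, hc⟩ := X.lintegral_le univ nullMeasurableSet_univ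
    have hfin : ∀ ν, X.eNorm (f - T ν) < ∞ := fun ν => by
      obtain ⟨d, hd⟩ := mem_trigPoly_iff.1 (hT ν)
      rw [hd]
      exact (X.eNorm_sub_le _ _).trans_lt (ENNReal.add_lt_top.2 ⟨hf, eNorm_trigSum_lt_top X _ d⟩)
    have hlim' : Tendsto (fun ν => ∫⁻ y, ‖f y - T ν y‖ₑ ∂torusMeasure) atTop (𝓝 0) := by
      have h0 : Tendsto (fun ν => (c : ℝ≥0∞) * X.eNorm (f - T ν)) atTop (𝓝 0) := by
        simpa using ENNReal.Tendsto.const_mul hlim (Or.inr ENNReal.coe_ne_top)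
      refine tendsto_of_tendsto_of_tendsto_of_le_of_le tendsto_const_nhds h0
        (fun _ => zero_le) fun ν => ?_
      have := hc _ (hfin ν)
      rwa [Measure.restrict_univ] at this
    have hfatou := lintegral_liminf_le' (μ := torusMeasure) (u := atTop)
      (f := fun ν y => ‖f y - T ν y‖ₑ)
      fun ν => (hfm.sub (hTc ν).measurable.aemeasurable).enorm
    rw [hlim'.liminf_eq] at hfatou
    have hpt : ∀ y, liminf (fun ν => ‖f y - T ν y‖ₑ) atTop = ‖f y - g y‖ₑ := fun y =>
      ((tendsto_const_nhds.sub (hTg y)).enorm).liminf_eq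
    simp only [hpt] at hfatou
    have hz := (lintegral_eq_zero_iff' (hfm.sub hgc.measurable.aemeasurable).enorm).1
      (le_antisymm hfatou zero_le)
    filter_upwards [hz] with y hy
    exact sub_eq_zero.1 (by simpa using hy)
  have hfg : f x = g x := hrep ⟨g, hgc⟩ hae x
  refine ⟨hsn x, ?_⟩
  rw [Pi.sub_apply, hfg, hg, add_sub_cancel_left]
  exact (hsn x).of_norm.hasSum

/-- Pointwise summation at the nodes gives domination of the step functions, to which the countable
triangle inequality applies. -/
theorem discreteNorm_le_tsum (n : ℕ) {f : Torus → ℂ} {u : ℕ → Torus → ℂ}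
    (hs : ∀ x, Summable fun ν => ‖u ν x‖) (hu : ∀ x, HasSum (fun ν => u ν x) (f x)) :
    G.discreteNorm n f ≤ ∑' ν, G.discreteNorm n (u ν) := by
  have hH : ∀ y, HasSum (fun ν => ‖G.step n (u ν) y‖) (∑ k ∈ Finset.range (G.m n),
      (arcSet (G.node n k) (G.node n (k + 1))).indicator
        (fun _ => ∑' ν, ‖u ν (G.node n k : Torus)‖) y) := by
    intro y
    simp only [step_eq_stepFn, norm_stepFn fun _ => norm_nonneg _]
    refine hasSum_sum fun k _ => ?_
    by_cases hy : y ∈ arcSet (G.node n k) (G.node n (k + 1))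
    · simpa [hy] using (hs _).hasSum
    · simp [hy]
  refine X.eNorm_le_tsum _ _ (measurable_stepFn fun k _ =>
    measurableSet_arcSet _ _).aemeasurable (fun y => (hH y).summable) fun y => ?_
  rw [(hH y).tsum_eq, step_eq_stepFn, norm_stepFn fun _ => norm_nonneg _]
  refine Finset.sum_le_sum fun k _ => indicator_le_indicator ?_
  rw [← (hu _).tsum_eq]
  exact norm_tsum_le_tsum_norm (hs _)

/-- Approximation by a trigonometric polynomial of degree `n` simultaneously in the norm of `X` and
in the discrete norm. -/
theorem exists_trigPoly_approx (hX : X.RearrangementInvariant) {n : ℕ} (hn : 1 ≤ n)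
    {f : Torus → ℂ} (hf : X.Mem f) (hrep : IsContinuousRepresentative f) {S : ℝ≥0∞}
    (hS : S = ∑' ν : ℕ, X.dilationNorm ((1 / 2) ^ (ν + 1)) * X.bestApprox (2 ^ ν * n) f)
    (hSfin : S ≠ ∞) {ε : ℝ≥0} (hε : 0 < ε) :
    ∃ T ∈ trigPoly n, X.eNorm (f - T) ≤ S + ε ∧
      G.discreteNorm n (f - T) ≤ G.samplingConst * (2 * (S + ε)) := by
  set D : ℕ → ℝ≥0∞ := fun ν => X.dilationNorm ((1 / 2) ^ (ν + 1)) with hD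
  set E : ℕ → ℝ≥0∞ := fun ν => X.bestApprox (2 ^ ν * n) f with hE
  set q : ℕ → ℝ≥0∞ := fun ν => 2⁻¹ ^ (ν + 1) with hq
  have hq0 : ∀ ν, q ν ≠ 0 := fun ν => pow_ne_zero _ (by simp)
  have hq1 : ∀ ν, q ν ≤ 1 := fun ν => pow_le_one₀ zero_le (by simp)
  have hqsum : ∑' ν, q ν = 1 := by
    simp only [hq, pow_succ, ENNReal.tsum_mul_right, ENNReal.tsum_geometric]
    rw [ENNReal.one_sub_inv_two, inv_inv]
    exact ENNReal.mul_inv_cancel (by norm_num) (by norm_num)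
  have hq2 : ∀ ν, 2 ^ (ν + 1) * q ν = 1 := fun ν => by
    rw [hq, ← mul_pow, ENNReal.mul_inv_cancel (by norm_num) (by norm_num), one_pow]
  have hEfin : ∀ ν, E ν ≠ ∞ := fun ν => by
    have : E ν ≤ X.eNorm (f - 0) := iInf₂_le (0 : Torus → ℂ) (Submodule.zero_mem _)
    rw [sub_zero] at this
    exact (this.trans_lt hf).ne
  have hEanti : ∀ ν, E (ν + 1) ≤ E ν := fun ν =>
    le_iInf₂ fun T hT => iInf₂_le T (trigPoly_mono (by gcongr <;> lia) hT)
  -- The infimum need not be attained. One factor `q ν` of the tolerance cancels the weight `2 ^ (ν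
  -- + 1)` and the other makes the tolerances sum to `ε`. Thus the tolerance is never multiplied by
  -- the dilation norm, which may be infinite where `E ν = 0`.
  have hex : ∀ ν, ∃ T ∈ trigPoly (2 ^ ν * n), X.eNorm (f - T) ≤ E ν + ε * (q ν * q ν) := by
    intro ν
    by_contra! hcon
    have h1 : E ν + ε * (q ν * q ν) ≤ E ν := le_iInf₂ fun T hT => (hcon T hT).le
    have h2 : (ε : ℝ≥0∞) * (q ν * q ν) ≠ 0 := by
      simp [hq0, hε.ne']
    exact absurd h1 (not_le.2 (ENNReal.lt_add_right (hEfin ν) h2))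
  choose T hT hTE using hex
  have hDE : ∀ ν, E ν ≤ D ν * E ν := fun ν =>
    le_mul_of_one_le_left zero_le (BanachFunctionLattice.one_le_dilationNorm _)
  have hfT : ∀ ν, X.eNorm (f - T ν) ≤ D ν * E ν + ε * q ν := fun ν =>
    (hTE ν).trans (add_le_add (hDE ν) (by gcongr; exact mul_le_of_le_one_left zero_le (hq1 ν)))
  have hbsum : ∑' ν, (D ν * E ν + ε * q ν) = S + ε := by
    rw [ENNReal.tsum_add, ENNReal.tsum_mul_left, hqsum, mul_one, hS]
  have hlim : Tendsto (fun ν => X.eNorm (f - T ν)) atTop (𝓝 0) :=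
    tendsto_of_tendsto_of_tendsto_of_le_of_le tendsto_const_nhds
      (ENNReal.tendsto_atTop_zero_of_tsum_ne_top (f := fun ν => D ν * E ν + ε * q ν)
        (by rw [hbsum]; exact ENNReal.add_ne_top.2 ⟨hSfin, ENNReal.coe_ne_top⟩))
      (fun _ => zero_le) hfT
  have hdiff : ∀ ν, X.eNorm (T (ν + 1) - T ν) ≤ 2 * (E ν + ε * (q ν * q ν)) := by
    intro ν
    have h1 : T (ν + 1) - T ν = (f - T ν) - (f - T (ν + 1)) := by abel
    have hq3 : q (ν + 1) ≤ q ν := by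
      simp only [hq]; exact pow_le_pow_of_le_one zero_le (by simp) (by lia)
    have h2 : X.eNorm (f - T (ν + 1)) ≤ E ν + ε * (q ν * q ν) :=
      (hTE (ν + 1)).trans (add_le_add (hEanti ν) (by gcongr))
    rw [h1, two_mul]
    exact (X.eNorm_sub_le _ _).trans (add_le_add (hTE ν) h2)
  have hw : ∑' ν, min (D ν) (2 ^ (ν + 1)) * X.eNorm (T (ν + 1) - T ν) ≤ 2 * (S + ε) := by
    rw [← hbsum, ← ENNReal.tsum_mul_left]
    refine ENNReal.tsum_le_tsum fun ν => ?_
    calc _ ≤ min (D ν) (2 ^ (ν + 1)) * (2 * (E ν + ε * (q ν * q ν))) := by gcongr; exact hdiff ν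
      _ = 2 * (min (D ν) (2 ^ (ν + 1)) * E ν + min (D ν) (2 ^ (ν + 1)) * (ε * (q ν * q ν))) := by
        ring
      _ ≤ 2 * (D ν * E ν + 2 ^ (ν + 1) * (ε * (q ν * q ν))) := by
        gcongr
        exacts [min_le_left _ _, min_le_right _ _]
      _ = 2 * (D ν * E ν + ε * ((2 ^ (ν + 1) * q ν) * q ν)) := by ring
      _ = _ := by rw [hq2, one_mul]
  have hwfin : ∑' ν, min (D ν) (2 ^ (ν + 1)) * X.eNorm (T (ν + 1) - T ν) ≠ ∞ :=
    (hw.trans_lt (ENNReal.mul_lt_top (by norm_num)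
      (ENNReal.add_lt_top.2 ⟨hSfin.lt_top, ENNReal.coe_lt_top⟩))).ne
  have hconv := G.hasSum_of_tendsto hX hn hf hrep hT hlim hwfin
  refine ⟨T 0, by simpa using hT 0, ?_, ?_⟩
  · refine (hfT 0).trans ?_
    rw [← hbsum]
    exact ENNReal.le_tsum (f := fun ν => D ν * E ν + ε * q ν) 0
  · refine (G.discreteNorm_le_tsum n (fun x => (hconv x).1) fun x => (hconv x).2).trans ?_
    calc _ ≤ ∑' ν, G.samplingConst *
          (min (D ν) (2 ^ (ν + 1)) * X.eNorm (T (ν + 1) - T ν)) :=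
          ENNReal.tsum_le_tsum fun ν => G.discreteNorm_trigPoly_le hX hn (ν + 1)
            (Submodule.sub_mem _ (hT _) (trigPoly_mono (by gcongr <;> lia) (hT ν)))
      _ ≤ _ := by rw [ENNReal.tsum_mul_left]; gcongr

theorem eNorm_sub_op_le {K₁ : ℝ≥0}
    (hA1 : ∀ n, 1 ≤ n → ∀ f, X.Mem f → X.eNorm (G.op n f) ≤ K₁ * G.discreteNorm n f) {n : ℕ}
    (hn : 1 ≤ n) {f T : Torus → ℂ} (hfT : X.Mem (f - T)) :
    X.eNorm (f - G.op n f)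
      ≤ X.eNorm (f - T) + X.eNorm (T - G.op n T) + K₁ * G.discreteNorm n (f - T) := by
  have h : f - G.op n f = ((f - T) + (T - G.op n T)) - G.op n (f - T) := by
    rw [G.op_sub]; abel
  rw [h]
  exact (X.eNorm_sub_le _ _).trans (add_le_add (X.eNorm_add_le _ _) (hA1 n hn _ hfT))

/-- The approximation order assumption in terms of the modulus of smoothness. -/
theorem eNorm_trigPoly_sub_op_le (hX : X.RearrangementInvariant) {s : ℕ} {K₃ : ℝ≥0}
    (hA3 : ∀ n : ℕ, 1 ≤ n → ∀ T ∈ trigPoly n,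
      X.eNorm (T - G.op n T) ≤ K₃ * ((n : ℝ≥0∞) ^ s)⁻¹ * X.eNorm (torusDeriv s T)) {n : ℕ}
    (hn : 1 ≤ n) (f : Torus → ℂ) {T : Torus → ℂ} (hT : T ∈ trigPoly n) :
    X.eNorm (T - G.op n T)
      ≤ K₃ * 16 ^ s * (X.modulus s f (1 / n) + 2 ^ s * X.eNorm (f - T)) := by
  have hn0 : (0 : ℝ) < n := by positivity
  have hn0' : (n : ℝ≥0∞) ^ s ≠ 0 := pow_ne_zero _ (by exact_mod_cast (by lia : n ≠ 0))
  have hn1 : (n : ℝ≥0∞) ^ s ≠ ∞ := ENNReal.pow_ne_top (ENNReal.natCast_ne_top n)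
  set h : ℝ := 1 / (8 * n) with hh
  have hmem : h ∈ Ioc (0 : ℝ) (1 / n) := by
    refine ⟨by positivity, ?_⟩
    rw [hh]
    gcongr
    linarith
  -- The step `h = 1 / (8 n)` required by the Nikolskii–Stechkin inequality is admissible in the
  -- modulus at `1 / n`.
  have hdiff : X.eNorm (difference s h T) ≤ X.modulus s f (1 / n) + 2 ^ s * X.eNorm (f - T) := by
    have e : difference s h T = difference s h f - difference s h (f - T) := by
      rw [BanachFunctionLattice.difference_sub]; abel
    rw [e]
    exact (X.eNorm_sub_le _ _).trans (add_le_add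
      (le_iSup₂ (f := fun h (_ : h ∈ Ioc (0 : ℝ) (1 / n)) => X.eNorm (difference s h f)) h hmem)
      (hX.eNorm_difference_le s h _))
  calc X.eNorm (T - G.op n T) ≤ K₃ * ((n : ℝ≥0∞) ^ s)⁻¹ * X.eNorm (torusDeriv s T) := hA3 n hn T hT
    _ ≤ K₃ * ((n : ℝ≥0∞) ^ s)⁻¹ * ((16 * n) ^ s * X.eNorm (difference s h T)) := by
      gcongr; exact hX.eNorm_torusDeriv_le hn s hT
    _ = K₃ * 16 ^ s * (((n : ℝ≥0∞) ^ s)⁻¹ * n ^ s) * X.eNorm (difference s h T) := by ring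
    _ ≤ _ := by
      rw [ENNReal.inv_mul_cancel hn0' hn1, mul_one]
      gcongr

end SamplingFamily

/-! ### Conclusion -/

theorem ENNReal.le_mul_of_forall_pos_le_mul_add {A S : ℝ≥0∞} {C : ℝ≥0} (hC : C ≠ 0)
    (h : ∀ ε : ℝ≥0, 0 < ε → A ≤ C * (S + ε)) : A ≤ C * S := by
  refine ENNReal.le_of_forall_pos_le_add fun ε hε _ => ?_
  have := h (ε / C) (div_pos hε (pos_iff_ne_zero.2 hC))
  rwa [mul_add, ← ENNReal.coe_mul, mul_div_cancel₀ _ hC] at this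

theorem theorem3p7 (X : BanachFunctionLattice) (hX : X.RearrangementInvariant)
    (G : SamplingFamily X) (s : ℕ) (hs : 1 ≤ s)
    (hA1 : G.Stable) (hA3 : G.ApproximatesOfOrder s) :
    (∃ C : ℝ≥0, ∀ f : Torus → ℂ, X.Mem f → IsContinuousRepresentative f → ∀ n : ℕ, 1 ≤ n →
      X.eNorm (f - G.op n f) ≤
        C * (X.modulus s f (1 / n) +
          ∑' ν : ℕ, X.dilationNorm ((1 / 2) ^ (ν + 1)) * X.bestApprox (2 ^ ν * n) f)) ∧
    (G.Reproduces →
      ∃ C : ℝ≥0, ∀ f : Torus → ℂ, X.Mem f → IsContinuousRepresentative f → ∀ n : ℕ, 1 ≤ n →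
        X.eNorm (f - G.op n f) ≤
          C * ∑' ν : ℕ, X.dilationNorm ((1 / 2) ^ (ν + 1)) * X.bestApprox (2 ^ ν * n) f) := by
  obtain ⟨K₁, hK₁⟩ := hA1
  obtain ⟨K₃, hK₃⟩ := hA3
  obtain ⟨Q, hQ : (Q : ℝ≥0∞) = G.samplingConst⟩ := WithTop.ne_top_iff_exists.1 G.samplingConst_ne_top
  have hmem : ∀ {f T : Torus → ℂ} {b : ℝ≥0∞} {ε : ℝ≥0}, b ≠ ∞ → X.eNorm (f - T) ≤ b + ε →
      X.Mem (f - T) := fun hb h =>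
    h.trans_lt (ENNReal.add_lt_top.2 ⟨hb.lt_top, ENNReal.coe_lt_top⟩)
  constructor
  · refine ⟨1 + 2 * K₁ * Q + K₃ * 16 ^ s * 2 ^ s, fun f hf hrep n hn => ?_⟩
    set S := ∑' ν : ℕ, X.dilationNorm ((1 / 2) ^ (ν + 1)) * X.bestApprox (2 ^ ν * n) f with hS
    have hC : 1 + 2 * K₁ * Q + K₃ * 16 ^ s * 2 ^ s ≠ 0 := by positivity
    by_cases hSfin : S = ∞
    · rw [hSfin, add_top, ENNReal.mul_top (by exact_mod_cast hC)]
      exact le_top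
    refine ENNReal.le_mul_of_forall_pos_le_mul_add hC fun ε hε => ?_
    obtain ⟨T, hT, h1, h2⟩ := G.exists_trigPoly_approx hX hn hf hrep hS hSfin hε
    rw [← hQ] at h2
    set ω := X.modulus s f (1 / n)
    have h3 := G.eNorm_trigPoly_sub_op_le hX hK₃ hn f hT
    -- This, together with the added term `(1 + 2 * K₁ * Q) * ω` below, gives `ω` the same
    -- coefficient as `S + ε`, so that the sum factors exactly.
    have hω : ω ≤ 2 ^ s * ω := le_mul_of_one_le_left zero_le (one_le_pow₀ (by norm_num))
    calc X.eNorm (f - G.op n f) ≤ X.eNorm (f - T) + X.eNorm (T - G.op n T)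
          + K₁ * G.discreteNorm n (f - T) := G.eNorm_sub_op_le hK₁ hn (hmem hSfin h1)
      _ ≤ (S + ε) + K₃ * 16 ^ s * (2 ^ s * ω + 2 ^ s * (S + ε)) + K₁ * (Q * (2 * (S + ε))) := by
        gcongr
        exact h3.trans (by gcongr)
      _ ≤ (S + ε) + K₃ * 16 ^ s * (2 ^ s * ω + 2 ^ s * (S + ε)) + K₁ * (Q * (2 * (S + ε)))
          + (1 + 2 * K₁ * Q) * ω := le_self_add
      _ = _ := by push_cast; ring
  · intro hrepr
    refine ⟨1 + 2 * K₁ * Q, fun f hf hrep n hn => ?_⟩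
    set S := ∑' ν : ℕ, X.dilationNorm ((1 / 2) ^ (ν + 1)) * X.bestApprox (2 ^ ν * n) f with hS
    have hC : 1 + 2 * K₁ * Q ≠ 0 := by positivity
    by_cases hSfin : S = ∞
    · rw [hSfin, ENNReal.mul_top (by exact_mod_cast hC)]
      exact le_top
    refine ENNReal.le_mul_of_forall_pos_le_mul_add hC fun ε hε => ?_
    obtain ⟨T, hT, h1, h2⟩ := G.exists_trigPoly_approx hX hn hf hrep hS hSfin hε
    rw [← hQ] at h2
    calc X.eNorm (f - G.op n f) ≤ X.eNorm (f - T) + X.eNorm (T - G.op n T)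
          + K₁ * G.discreteNorm n (f - T) := G.eNorm_sub_op_le hK₁ hn (hmem hSfin h1)
      _ ≤ (S + ε) + 0 + K₁ * (Q * (2 * (S + ε))) := by
        rw [hrepr n hn T hT, sub_self, X.eNorm_zero]
        gcongr
      _ = _ := by push_cast; ring
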